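/- Let $\Sigma$ be a smooth (Hausdorff, second countable) three-manifold without boundary. A \emph{Cauchy pair} $(\mathfrak e,\Theta)$ on $\Sigma$ consists of a smooth global coframe $\mathfrak e=(e_u,e_l,e_n)$ and a smooth symmetric tensor $\Theta\in\Gamma(S^2T^*\Sigma)$. Let $\mathfrak e^\sharp=(e_u^\sharp,e_l^\sharp,e_n^\sharp)$ be the dual frame, which is the metric dual of $\mathfrak e$ with respect to $h_{\mathfrak e}=e_u\otimes e_u+e_l\otimes e_l+e_n\otimes e_n$, and write $\Theta(e_a)=\Theta(e_a^\sharp,\cdot)$. The pair is \emph{parallel} if $$\mathrm d e_a=\Theta(e_a)\wedge e_u\quad (a=u,l,n),\qquad [\Theta(e_u)]=0\in H^1(\Sigma,\mathbb R),$$ and \emph{complete} if the Riemannian manifold $(\Sigma,h_{\mathfrak e})$ is complete. Let $(\mathfrak e,\Theta)$ be a complete parallel Cauchy pair on $\Sigma$. Then the smooth vector fields $e_l^\sharp$ and $e_n^\sharp$ are complete and $[e_l^\sharp,e_n^\sharp]=0$. There is a unique action of the group $\mathbb R^2$ on $\Sigma$ for which, for every $p\in\Sigma$, the curves $t\mapsto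 (t,0)\cdot p$ and $t\mapsto(0,t)\cdot p$ are integral curves of $e_l^\sharp$ and $e_n^\sharp$ respectively. This action is smooth and locally free (every isotropy group is discrete), and its orbits are exactly the leaves of the foliation of $\Sigma$ tangent to $\ker e_u$, that is, the maximal connected integral manifolds of the distribution $\ker e_u\subset T\Sigma$. -/

import Mathlib

open scoped Manifold ContDiff ENNReal

noncomputable section

/-- Model space of three-manifolds. -/
abbrev E3 : Type := EuclideanSpace ℝ (Fin 3)

/-- Model space of surfaces. -/
abbrev E2 : Type := EuclideanSpace ℝ (Fin 2)

section Fields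

variable {S : Type*} [TopologicalSpace S] [ChartedSpace E3 S]

/-- A (not necessarily smooth) vector field on a three-manifold. -/
abbrev VField (S : Type*) [TopologicalSpace S] [ChartedSpace E3 S] : Type _ :=
  (x : S) → TangentSpace (𝓡 3) x

/-- A (not necessarily smooth) one-form on a three-manifold. -/
abbrev OneForm (S : Type*) [TopologicalSpace S] [ChartedSpace E3 S] : Type _ :=
  (x : S) → (TangentSpace (𝓡 3) x →L[ℝ] ℝ)

/-- A (not necessarily smooth) tensor field with two covariant slots on a three-manifold. -/
abbrev TwoTensor (S : Type*) [TopologicalSpace S] [ChartedSpace E3 S] : Type _ :=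
  (x : S) → (TangentSpace (𝓡 3) x →L[ℝ] TangentSpace (𝓡 3) x →L[ℝ] ℝ)

/-- Smooth sections of the tangent bundle. -/
def IsSmoothVField [IsManifold (𝓡 3) ∞ S] (X : VField S) : Prop :=
  ContMDiff (𝓡 3) ((𝓡 3).prod 𝓘(ℝ, E3)) ∞
    (fun x => (Bundle.TotalSpace.mk' E3 x (X x) : TangentBundle (𝓡 3) S))

/-- Smooth sections of the cotangent bundle. -/
def IsSmoothOneForm [IsManifold (𝓡 3) ∞ S] (a : OneForm S) : Prop :=
  ContMDiff (𝓡 3) ((𝓡 3).prod 𝓘(ℝ, E3 →L[ℝ] ℝ)) ∞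
    (fun x => Bundle.TotalSpace.mk' (E3 →L[ℝ] ℝ)
      (E := fun x : S => TangentSpace (𝓡 3) x →L[ℝ] ℝ) x (a x))

/-- Smooth sections of the bundle of bilinear forms on tangent spaces. -/
def IsSmoothTwoTensor [IsManifold (𝓡 3) ∞ S] (T : TwoTensor S) : Prop :=
  ContMDiff (𝓡 3) ((𝓡 3).prod 𝓘(ℝ, E3 →L[ℝ] E3 →L[ℝ] ℝ)) ∞
    (fun x => Bundle.TotalSpace.mk' (E3 →L[ℝ] E3 →L[ℝ] ℝ)
      (E := fun x : S => TangentSpace (𝓡 3) x →L[ℝ] TangentSpace (𝓡 3) x →L[ℝ] ℝ) x (T x))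

/-- The exterior derivative of a one-form evaluated on two vector fields, by the invariant formula
`da (X, Y) = X (a Y) - Y (a X) - a [X, Y]`; it is used for smooth `a`, `X`, `Y`. -/
def extD (a : OneForm S) (X Y : VField S) (x : S) : ℝ :=
  mvfderiv (𝓡 3) (fun y => a y (Y y)) x (X x) - mvfderiv (𝓡 3) (fun y => a y (X y)) x (Y x)
    - a x (VectorField.mlieBracket (𝓡 3) X Y x)

/-- The wedge product of two one-forms evaluated on two vector fields. -/
def wedge (a b : OneForm S) (X Y : VField S) (x : S) : ℝ :=
  a x (X x) * b x (Y x) - a x (Y x) * b x (X x)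

/-- The two-form equation `da = b ∧ c`, tested on all pairs of smooth vector fields. -/
def ExtDEqWedge [IsManifold (𝓡 3) ∞ S] (a b c : OneForm S) : Prop :=
  ∀ X Y : VField S, IsSmoothVField X → IsSmoothVField Y →
    ∀ x : S, extD a X Y x = wedge b c X Y x

/-- A one-form that is the differential of a globally defined smooth function, that is, a closed
one-form whose class in the first de Rham cohomology group vanishes. -/
def IsExactOneForm (a : OneForm S) : Prop :=
  ∃ f : S → ℝ, ContMDiff (𝓡 3) 𝓘(ℝ, ℝ) ∞ f ∧ ∀ x : S, a x = mvfderiv (𝓡 3) f x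

/-- A vector field is complete if through every point passes an integral curve that is defined for
all times. -/
def IsCompleteVField (X : VField S) : Prop :=
  ∀ p : S, ∃ c : ℝ → S, c 0 = p ∧ IsMIntegralCurve (I := 𝓡 3) c X

end Fields

/-- A Cauchy pair: a smooth global coframe `e = (e_u, e_l, e_n)` (the indices `0`, `1`, `2` stand
for `u`, `l`, `n`) and a smooth symmetric bilinear form `Th` on the tangent bundle. -/
structure CauchyPair (S : Type*) [TopologicalSpace S] [ChartedSpace E3 S]
    [IsManifold (𝓡 3) ∞ S] where
  e : Fin 3 → OneForm S
  e_smooth : ∀ i, IsSmoothOneForm (e i)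
  e_indep : ∀ x : S, LinearIndependent ℝ (fun i => e i x)
  Th : TwoTensor S
  Th_smooth : IsSmoothTwoTensor Th
  Th_symm : ∀ (x : S) (v w : TangentSpace (𝓡 3) x), Th x v w = Th x w v

namespace CauchyPair

variable {S : Type*} [TopologicalSpace S] [ChartedSpace E3 S] [IsManifold (𝓡 3) ∞ S]

/-- The three covectors of the coframe at `x`, as a linear map to `ℝ³`. -/
def coord (P : CauchyPair S) (x : S) : TangentSpace (𝓡 3) x →ₗ[ℝ] (Fin 3 → ℝ) :=
  LinearMap.pi fun i => (P.e i x).toLinearMap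

theorem coord_bijective (P : CauchyPair S) (x : S) : Function.Bijective (P.coord x) := by
  have hsurj : Function.Surjective (P.coord x) := by
    rw [← LinearMap.range_eq_top]
    by_contra hne
    obtain ⟨φ, hφ, hle⟩ := Submodule.exists_le_ker_of_lt_top _ (lt_top_iff_ne_top.2 hne)
    have hz : ∑ i, φ (Pi.single i 1) • P.e i x = 0 := by
      ext v
      have h1 : φ (P.coord x v) = 0 := hle ⟨v, rfl⟩
      rw [pi_eq_sum_univ' (P.coord x v), map_sum] at h1
      simp only [map_smul, smul_eq_mul] at h1
      rw [sum_apply]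
      simp only [smul_apply, smul_eq_mul, zero_apply]
      rw [← h1]
      refine Finset.sum_congr rfl fun i _ => ?_
      rw [mul_comm]
      congr 2
    have hc := Fintype.linearIndependent_iff.1 (P.e_indep x) _ hz
    apply hφ
    refine LinearMap.pi_ext' fun i => ?_
    ext
    simpa using hc i
  have : FiniteDimensional ℝ (TangentSpace (𝓡 3) x) :=
    inferInstanceAs (FiniteDimensional ℝ E3)
  have hdim : Module.finrank ℝ (TangentSpace (𝓡 3) x) = Module.finrank ℝ (Fin 3 → ℝ) := by
    have h3 : Module.finrank ℝ E3 = 3 := by simp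
    rw [Module.finrank_fin_fun]
    exact h3
  exact ⟨(LinearMap.injective_iff_surjective_of_finrank_eq_finrank hdim).2 hsurj, hsurj⟩

/-- The frame `e^♯` dual to the coframe: `e_j (e_i^♯) = δ_ij`. -/
def sharp (P : CauchyPair S) (i : Fin 3) : VField S := fun x =>
  (LinearEquiv.ofBijective (P.coord x) (P.coord_bijective x)).symm (Pi.single i 1)

theorem e_sharp (P : CauchyPair S) (i j : Fin 3) (x : S) :
    P.e j x (P.sharp i x) = if j = i then 1 else 0 := by
  have h : P.coord x (P.sharp i x) = Pi.single i 1 :=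
    (LinearEquiv.ofBijective (P.coord x) (P.coord_bijective x)).apply_symm_apply _
  have h2 := congrFun h j
  rw [Pi.single_apply] at h2
  exact h2

/-- The Riemannian metric `h = e_u ⊗ e_u + e_l ⊗ e_l + e_n ⊗ e_n` of the coframe. -/
def metric (P : CauchyPair S) (x : S) (v w : TangentSpace (𝓡 3) x) : ℝ :=
  ∑ i, P.e i x v * P.e i x w

/-- The dual frame consists of the metric duals of the coframe. -/
theorem metric_sharp (P : CauchyPair S) (i : Fin 3) (x : S) (w : TangentSpace (𝓡 3) x) :
    P.metric x (P.sharp i x) w = P.e i x w := by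
  simp [metric, e_sharp]

/-- The one-form `Θ(e_i) = Θ(e_i^♯, ·)`. -/
def thE (P : CauchyPair S) (i : Fin 3) : OneForm S := fun x => P.Th x (P.sharp i x)

/-- The parallel Cauchy differential system: `de = Θ(e) ∧ e_u` and `[Θ(e_u)] = 0`. -/
structure IsParallel (P : CauchyPair S) : Prop where
  ext_eq : ∀ i, ExtDEqWedge (P.e i) (P.thE i) (P.e 0)
  exact_u : IsExactOneForm (P.thE 0)

/-- The Riemannian distance of the metric of the coframe, the infimum of the lengths of `C^1`
paths (infinite between different components). -/
def rDist (P : CauchyPair S) (x y : S) : ℝ≥0∞ :=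
  letI : ∀ x : S, ENorm (TangentSpace (𝓡 3) x) :=
    fun x => ⟨fun v => ENNReal.ofReal (Real.sqrt (P.metric x v v))⟩
  Manifold.riemannianEDist (𝓡 3) x y

/-- Completeness of the Riemannian manifold `(S, h)`: Cauchy sequences for the Riemannian distance
converge (the topology of that distance is the topology of the manifold). -/
def IsComplete (P : CauchyPair S) : Prop :=
  ∀ s : ℕ → S,
    (∀ ε : ℝ≥0∞, 0 < ε → ∃ N, ∀ m ≥ N, ∀ n ≥ N, P.rDist (s m) (s n) < ε) →
    ∃ p : S, Filter.Tendsto s Filter.atTop (nhds p)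

end CauchyPair

section Leaves

/-- `L` is a connected integral manifold of the plane distribution `ker a`: the image of a nonempty
connected surface under an injective smooth immersion whose tangent planes are the planes of the
distribution. -/
def IsIntegralSurface.{u} {S : Type u} [TopologicalSpace S] [ChartedSpace E3 S]
    (a : OneForm S) (L : Set S) : Prop :=
  ∃ (N : Type u) (_ : TopologicalSpace N) (_ : ChartedSpace E2 N) (f : N → S),
    IsManifold (𝓡 2) ∞ N ∧ T2Space N ∧ SecondCountableTopology N ∧ ConnectedSpace N ∧
    ContMDiff (𝓡 2) (𝓡 3) ∞ f ∧ Function.Injective f ∧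
    (∀ y : N, Function.Injective (mfderiv (𝓡 2) (𝓡 3) f y)) ∧
    (∀ y : N, Set.range (mfderiv (𝓡 2) (𝓡 3) f y) = {v | a (f y) v = 0}) ∧
    Set.range f = L

/-- The leaves of the foliation tangent to `ker a`: its maximal connected integral manifolds. -/
def IsLeaf.{u} {S : Type u} [TopologicalSpace S] [ChartedSpace E3 S]
    (a : OneForm S) (L : Set S) : Prop :=
  IsIntegralSurface a L ∧ ∀ L' : Set S, IsIntegralSurface a L' → L ⊆ L' → L' = L

end Leaves

section Actions

variable {S : Type*} [TopologicalSpace S] [ChartedSpace E3 S]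

/-- The action `A` of `ℝ²` is generated by the vector fields `X`, `Y`: the first and the second
factor act by their flows. -/
def IsGeneratedBy (A : AddAction (ℝ × ℝ) S) (X Y : VField S) : Prop :=
  ∀ p : S, IsMIntegralCurve (I := 𝓡 3) (fun t : ℝ => ((t, 0) : ℝ × ℝ) +ᵥ p) X ∧
    IsMIntegralCurve (I := 𝓡 3) (fun t : ℝ => ((0, t) : ℝ × ℝ) +ᵥ p) Y

/-- The action map `ℝ² × S → S` is smooth. -/
def IsSmoothAction (A : AddAction (ℝ × ℝ) S) : Prop :=
  ContMDiffVAdd 𝓘(ℝ, ℝ × ℝ) (𝓡 3) ∞ (ℝ × ℝ) S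

/-- The action is locally free: all isotropy groups are discrete. -/
def IsLocallyFreeAction (A : AddAction (ℝ × ℝ) S) : Prop :=
  ∀ p : S, DiscreteTopology (AddAction.stabilizer (ℝ × ℝ) p)

/-- The set of orbits of the action. -/
def orbitSet (A : AddAction (ℝ × ℝ) S) : Set (Set S) :=
  Set.range fun p : S => AddAction.orbit (ℝ × ℝ) p

end Actions

end

open Set Filter Topology

/-! ### Parameter integrals and a fibrewise Poincaré lemma -/

section

/-! Everything rests on local coordinates in which both leaf fields are constant. If Θ(e_u) = dF,
then de_u = dF ∧ e_u makes exp(-F) e_u closed, so locally it equals dz, and the levels of z are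
tangent to ker e_u. On these levels e_u vanishes, hence e_l and e_n restrict to closed forms there
and have primitives l₁, l₂ along the levels, smooth in all variables by a Poincaré lemma with
parameters. In the chart (z, l₁, l₂) the fields e_l^♯ and e_n^♯ are the last two coordinate fields
(`exists_straightening_of_coframe`, `IsParallel.exists_isStraightening`), and their flows are
translations.

Completeness: a combination of the leaf fields with constant coefficients has constant length, so
its integral curves are Lipschitz. At a finite end time such a curve has a limit by completeness of
the metric, and near the limit the existence time is uniform; so the curve extends
(`exists_extend_right`, `isComplete_leafField`).

The flows commute locally because translations do, and then globally by continuation in the two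
times (`flow_commute_of_local`); this gives the action. Smoothness holds near the zero vector by the
charts and spreads over ℝ² by the group law. Local freeness is the injectivity of small
translations.

Each orbit is a quotient of the plane with translations as transition maps, hence an immersed
integral surface. Conversely z is locally constant on any integral surface, so a connected one stays
in a single orbit (`subset_orbit`). Orbits are therefore exactly the maximal connected integral
surfaces. -/

theorem hasFDerivAt_intervalIntegral_of_contDiff {E F : Type*} [NormedAddCommGroup E]
    [NormedSpace ℝ E] [FiniteDimensional ℝ E] [NormedAddCommGroup F] [NormedSpace ℝ F]
    {g : ℝ → E → F} (hg : ContDiff ℝ 1 (Function.uncurry g)) (x : E) :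
    HasFDerivAt (fun x => ∫ t in (0 : ℝ)..1, g t x) (∫ t in (0 : ℝ)..1, fderiv ℝ (g t) x) x := by
  have hd : ∀ t, Differentiable ℝ (g t) := fun t =>
    (hg.comp (contDiff_prodMk_right t)).differentiable one_ne_zero
  have hc : Continuous (fun q : E × ℝ => fderiv ℝ (g q.2) q.1) := by
    have h : ContDiff ℝ 1 (Function.uncurry fun (q : E × ℝ) (y : E) => g q.2 y) :=
      hg.comp (contDiff_fst.snd.prodMk contDiff_snd)
    exact (ContDiff.fderiv (m := 1) (n := 0) h contDiff_fst (by norm_num)).continuous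
  obtain ⟨C, hC⟩ := ((isCompact_closedBall x 1).prod (isCompact_Icc (a := (0 : ℝ)) (b := 1))
    ).exists_bound_of_continuousOn hc.continuousOn
  refine intervalIntegral.hasFDerivAt_integral_of_dominated_of_fderiv_le
    (F := fun x t => g t x) (F' := fun x t => fderiv ℝ (g t) x) (bound := fun _ => C)
    (Metric.closedBall_mem_nhds x one_pos) ?_ ?_ ?_ ?_ ?_ ?_
  · exact Eventually.of_forall fun y =>
      (hg.continuous.comp (by fun_prop : Continuous fun t : ℝ => (t, y))).aestronglyMeasurable
  · exact (hg.continuous.comp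
      (by fun_prop : Continuous fun t : ℝ => (t, x))).intervalIntegrable _ _
  · exact (hc.comp (by fun_prop : Continuous fun t : ℝ => (x, t))).aestronglyMeasurable
  · refine Eventually.of_forall fun t ht y hy => hC (y, t) ⟨hy, ?_⟩
    rw [uIoc_of_le zero_le_one] at ht
    exact ⟨ht.1.le, ht.2⟩
  · exact intervalIntegrable_const
  · exact Eventually.of_forall fun t _ y _ => (hd t y).hasFDerivAt

/-- The derivative of the integral is again a parameter integral, with values in `E →L[ℝ] F`. The
induction on the order therefore runs over all targets, which is why `E` and `F` share a universe.
-/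
theorem contDiff_intervalIntegral.{u} {E F : Type u} [NormedAddCommGroup E]
    [NormedSpace ℝ E] [FiniteDimensional ℝ E] [NormedAddCommGroup F] [NormedSpace ℝ F]
    {g : ℝ → E → F} (hg : ContDiff ℝ ∞ (Function.uncurry g)) :
    ContDiff ℝ ∞ (fun x => ∫ t in (0 : ℝ)..1, g t x) := by
  rw [contDiff_infty]
  intro n
  induction n generalizing F with
  | zero =>
    exact contDiff_zero.2 (continuous_iff_continuousAt.2 fun x =>
      (hasFDerivAt_intervalIntegral_of_contDiff (hg.of_le (by simp)) x).continuousAt)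
  | succ n ih =>
    have h := hasFDerivAt_intervalIntegral_of_contDiff (hg.of_le (by simp))
    rw [Nat.cast_succ, contDiff_succ_iff_fderiv]
    refine ⟨fun x => (h x).differentiableAt, by simp, ?_⟩
    rw [show fderiv ℝ (fun x => ∫ t in (0 : ℝ)..1, g t x) = _ from funext fun x => (h x).fderiv]
    refine ih (g := fun t x => fderiv ℝ (g t) x) ?_
    have h' : ContDiff ℝ ∞ (Function.uncurry fun (q : ℝ × E) (y : E) => g q.1 y) :=
      hg.comp (contDiff_fst.fst.prodMk contDiff_snd)
    exact ContDiff.fderiv (n := ∞) (m := ∞) h' contDiff_snd (by simp)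

/-- A germ of a smooth map extends to a globally smooth map. -/
theorem exists_contDiff_eventuallyEq {E F : Type*} [NormedAddCommGroup E]
    [NormedSpace ℝ E] [FiniteDimensional ℝ E] [NormedAddCommGroup F] [NormedSpace ℝ F]
    {f : E → F} {a : E} (hf : ∀ᶠ y in 𝓝 a, ContDiffAt ℝ ∞ f y) :
    ∃ g : E → F, ContDiff ℝ ∞ g ∧ g =ᶠ[𝓝 a] f := by
  obtain ⟨r, hr, h⟩ := Metric.eventually_nhds_iff_ball.1 hf
  let χ : ContDiffBump a := ⟨r / 4, r / 2, by positivity, by linarith⟩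
  refine ⟨fun y => χ y • f y, contDiff_iff_contDiffAt.2 fun y => ?_, ?_⟩
  · by_cases hy : y ∈ Metric.ball a r
    · exact χ.contDiffAt.smul (h y hy)
    · refine (contDiffAt_const (c := (0 : F))).congr_of_eventuallyEq ?_
      have : y ∈ (tsupport χ)ᶜ := by
        rw [χ.tsupport_eq]
        simp only [Metric.mem_ball, not_lt, mem_compl_iff, Metric.mem_closedBall, not_le] at hy ⊢
        exact lt_of_lt_of_le (by simp [χ]; linarith) hy
      filter_upwards [(isClosed_tsupport χ).isOpen_compl.mem_nhds this] with w hw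
      rw [image_eq_zero_of_notMem_tsupport hw, zero_smul]
  · filter_upwards [χ.eventuallyEq_one] with y hy
    simp [hy]

/-- Fibrewise Poincaré lemma: a one-form closed along the fibres of a linear functional is exact
along them, with smooth primitive. -/
theorem exists_primitive_along_ker {E : Type} [NormedAddCommGroup E]
    [NormedSpace ℝ E] [FiniteDimensional ℝ E] (lam : E →L[ℝ] ℝ) {α : E → E →L[ℝ] ℝ} {b : E}
    (hα : ∀ᶠ y in 𝓝 b, ContDiffAt ℝ ∞ α y)
    (hclosed : ∀ᶠ y in 𝓝 b, ∀ v w, lam v = 0 → lam w = 0 → fderiv ℝ α y v w = fderiv ℝ α y w v) :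
    ∃ l : E → ℝ, (∀ᶠ y in 𝓝 b, ContDiffAt ℝ ∞ l y) ∧
      ∀ᶠ y in 𝓝 b, ∀ v, lam v = 0 → fderiv ℝ l y v = α y v := by
  -- `Q` is a projection onto the kernel of `lam`, the identity if `lam = 0`.
  obtain ⟨Q, hQ0, hQ1⟩ : ∃ Q : E →L[ℝ] E, (∀ v, lam (Q v) = 0) ∧ ∀ v, lam v = 0 → Q v = v := by
    by_cases h0 : lam = 0
    · exact ⟨.id ℝ E, by simp [h0], by simp⟩
    · obtain ⟨v, hv⟩ : ∃ v, lam v ≠ 0 := by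
        by_contra! h
        exact h0 (ContinuousLinearMap.ext h)
      refine ⟨.id ℝ E - lam.smulRight ((lam v)⁻¹ • v), fun w => ?_, fun w hw => ?_⟩
      · simp [hv]
      · simp [hw]
  obtain ⟨A, hA, hAα⟩ := exists_contDiff_eventuallyEq hα
  have hclosedA : ∀ᶠ y in 𝓝 b, ∀ v w, lam v = 0 → lam w = 0 →
      fderiv ℝ A y v w = fderiv ℝ A y w v := by
    filter_upwards [hclosed, hAα.fderiv (𝕜 := ℝ)] with y h1 h2
    rw [h2]
    exact h1
  obtain ⟨r, hr, hball⟩ := Metric.eventually_nhds_iff_ball.1 hclosedA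
  -- For fixed `x` this is the segment, inside the level of `lam` through `x`, from `x - Q (x - b)`
  -- to `x`; the primitive is the integral of `A` along it.
  set h : ℝ → E → E := fun t x => x - (1 - t) • Q (x - b) with hh
  set g : ℝ → E → ℝ := fun t x => A (h t x) (Q (x - b)) with hg
  have hgs : ContDiff ℝ ∞ (Function.uncurry g) := by
    have h1 : ContDiff ℝ ∞ (fun q : ℝ × E => h q.1 q.2) := by
      simp only [hh]
      fun_prop
    have h2 : ContDiff ℝ ∞ (fun q : ℝ × E => Q (q.2 - b)) := by fun_prop
    exact (hA.comp h1).clm_apply h2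
  refine ⟨fun x => ∫ t in (0 : ℝ)..1, g t x,
    Eventually.of_forall fun y => (contDiff_intervalIntegral hgs).contDiffAt, ?_⟩
  have hAd : Differentiable ℝ A := hA.differentiable (by simp)
  have hnear : ∀ᶠ x in 𝓝 b, ∀ t ∈ Icc (0 : ℝ) 1, h t x ∈ Metric.ball b r := by
    have hpos : 0 < r / (1 + ‖Q‖) := by positivity
    filter_upwards [Metric.ball_mem_nhds b hpos] with x hx t ht
    rw [mem_ball_iff_norm] at hx ⊢
    rw [lt_div_iff₀ (by positivity)] at hx
    calc ‖h t x - b‖ = ‖(x - b) - (1 - t) • Q (x - b)‖ := by simp only [hh]; congr 1; abel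
      _ ≤ ‖x - b‖ + ‖(1 - t) • Q (x - b)‖ := norm_sub_le _ _
      _ ≤ ‖x - b‖ + 1 * (‖Q‖ * ‖x - b‖) := by
        rw [norm_smul]
        gcongr
        · rw [Real.norm_eq_abs, abs_le]
          constructor <;> linarith [ht.1, ht.2]
        · exact Q.le_opNorm _
      _ = ‖x - b‖ * (1 + ‖Q‖) := by ring
      _ < r := hx
  filter_upwards [hnear, hAα.eventually_nhds] with x hx hxα v hv
  have hgx := hasFDerivAt_intervalIntegral_of_contDiff (hgs.of_le (by simp)) x
  have hht : ∀ t, HasDerivAt (fun s => h s x) (Q (x - b)) t := fun t => by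
    have := ((((hasDerivAt_id t).const_sub 1).smul_const (Q (x - b))).const_sub x)
    simpa [hh] using this
  have hhx : ∀ t, HasFDerivAt (h t) (.id ℝ E - (1 - t) • Q) x := fun t => by
    have h1 : HasFDerivAt (fun y : E => Q (y - b)) Q x :=
      Q.hasFDerivAt.comp x ((hasFDerivAt_id x).sub_const b)
    exact (hasFDerivAt_id x).sub (h1.const_smul (1 - t))
  have hgd : ∀ t, fderiv ℝ (g t) x v = t * fderiv ℝ A (h t x) v (Q (x - b)) + A (h t x) v := by
    intro t
    have h1 : HasFDerivAt (fun y : E => Q (y - b)) Q x :=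
      Q.hasFDerivAt.comp x ((hasFDerivAt_id x).sub_const b)
    have h2 := ((hAd (h t x)).hasFDerivAt.comp x (hhx t)).clm_apply h1
    have h3 : fderiv ℝ (g t) x = _ := h2.fderiv
    rw [h3]
    simp [hQ1 v hv, sub_smul]
    ring
  -- Closedness along the fibres turns the derivative of the integrand in the direction `v` into a
  -- total derivative in `t`, so the integral telescopes to the value at `t = 1`.
  have hder : ∀ t ∈ uIcc (0 : ℝ) 1,
      HasDerivAt (fun t => t * A (h t x) v) (fderiv ℝ (g t) x v) t := by
    intro t ht
    rw [uIcc_of_le zero_le_one] at ht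
    have h1 : HasDerivAt (fun s => A (h s x) v) (fderiv ℝ A (h t x) (Q (x - b)) v) t := by
      have := ((hAd (h t x)).hasFDerivAt.comp_hasDerivAt t (hht t))
      exact this.clm_apply (hasDerivAt_const t v) |>.congr_deriv (by simp)
    refine ((hasDerivAt_id t).mul h1).congr_deriv ?_
    rw [hgd, hball _ (hx t ht) v _ hv (hQ0 _)]
    simp
    ring
  have hcont : Continuous fun t => fderiv ℝ (g t) x := by
    have h : ContDiff ℝ 1 (Function.uncurry fun (t : ℝ) (y : E) => g t y) := hgs.of_le (by simp)
    exact (ContDiff.fderiv (m := 1) (n := 0) h contDiff_const (by norm_num)).continuous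
  rw [hgx.fderiv, ← ContinuousLinearMap.apply_apply v (∫ t in (0 : ℝ)..1, fderiv ℝ (g t) x),
    ← ContinuousLinearMap.intervalIntegral_comp_comm _ (hcont.intervalIntegrable _ _)]
  simp only [ContinuousLinearMap.apply_apply]
  rw [intervalIntegral.integral_eq_sub_of_hasDerivAt hder
    ((hcont.clm_apply continuous_const).intervalIntegrable _ _)]
  have : h 1 x = x := by simp [hh]
  rw [this, hxα.self_of_nhds]
  simp

end

/-! ### Inverse function theorem and straightening of a coframe -/

section

/-- The inverse function theorem with smoothness of both maps on their whole domains. -/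
theorem exists_smooth_openPartialHomeomorph {E F : Type*} [NormedAddCommGroup E] [NormedSpace ℝ E]
    [CompleteSpace E] [NormedAddCommGroup F] [NormedSpace ℝ F]
    {Φ : E → F} {a : E} {U : Set E} (hU : U ∈ 𝓝 a)
    (hΦ : ∀ᶠ y in 𝓝 a, ContDiffAt ℝ ∞ Φ y) (L : E ≃L[ℝ] F)
    (hL : fderiv ℝ Φ a = L) :
    ∃ ψ : OpenPartialHomeomorph E F, a ∈ ψ.source ∧ ψ.source ⊆ U ∧ (ψ : E → F) = Φ ∧
      (∀ y ∈ ψ.source, ContDiffAt ℝ ∞ Φ y) ∧ ∀ y ∈ ψ.target, ContDiffAt ℝ ∞ ψ.symm y := by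
  have h0 : ContDiffAt ℝ ∞ Φ a := hΦ.self_of_nhds
  have hd : HasFDerivAt Φ (L : E →L[ℝ] F) a := hL ▸ (h0.differentiableAt (by simp)).hasFDerivAt
  set ψ₀ := h0.toOpenPartialHomeomorph Φ hd (by simp) with hψ₀
  have ha : a ∈ ψ₀.source := h0.mem_toOpenPartialHomeomorph_source hd (by simp)
  have hcoe : (ψ₀ : E → F) = Φ := rfl
  -- Invertible maps form an open set. Shrinking the domain to points with invertible derivative
  -- makes the inverse smooth at every point of the target, not only at `Φ a`.
  have hinv : ∀ᶠ y in 𝓝 a, ∃ M : E ≃L[ℝ] F, fderiv ℝ Φ y = M := by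
    have hc : ContinuousAt (fderiv ℝ Φ) a := (h0.fderiv_right (m := 0) (by simp)).continuousAt
    have : {M : E →L[ℝ] F | ∃ N : E ≃L[ℝ] F, M = N} ∈ 𝓝 (fderiv ℝ Φ a) := by
      rw [hL]
      filter_upwards [L.nhds] with M hM
      obtain ⟨N, hN⟩ := hM
      exact ⟨N, hN.symm⟩
    exact hc this
  obtain ⟨W, hW, hWo, haW⟩ := eventually_nhds_iff.1
    ((hΦ.and hinv).and (mem_nhds_iff.1 hU |>.elim fun V hV =>
      eventually_of_mem (hV.2.1.mem_nhds hV.2.2) hV.1))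
  refine ⟨ψ₀.restrOpen W hWo, ⟨ha, haW⟩, fun y hy => (hW y hy.2).2, rfl,
    fun y hy => (hW y hy.2).1.1, fun y hy => ?_⟩
  have hs := (ψ₀.restrOpen W hWo).map_target hy
  obtain ⟨⟨h1, M, hM⟩, -⟩ := hW _ hs.2
  have h2 : HasFDerivAt (ψ₀.restrOpen W hWo) (M : E →L[ℝ] F) ((ψ₀.restrOpen W hWo).symm y) :=
    hM ▸ (h1.differentiableAt (by simp)).hasFDerivAt
  exact (ψ₀.restrOpen W hWo).contDiffAt_symm hy h2 h1

/-- A one-form closed along the level sets of a submersion to the line is exact along them, with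
smooth primitive. -/
theorem exists_primitive_along_levels {E : Type} [NormedAddCommGroup E]
    [NormedSpace ℝ E] [FiniteDimensional ℝ E] {z : E → ℝ} {α : E → E →L[ℝ] ℝ} {a : E}
    (hz : ∀ᶠ y in 𝓝 a, ContDiffAt ℝ ∞ z y) (hz0 : fderiv ℝ z a ≠ 0)
    (hα : ∀ᶠ y in 𝓝 a, ContDiffAt ℝ ∞ α y)
    (hclosed : ∀ᶠ y in 𝓝 a, ∀ v w, fderiv ℝ z y v = 0 → fderiv ℝ z y w = 0 →
      fderiv ℝ α y v w = fderiv ℝ α y w v) :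
    ∃ l : E → ℝ, (∀ᶠ y in 𝓝 a, ContDiffAt ℝ ∞ l y) ∧
      ∀ᶠ y in 𝓝 a, ∀ v, fderiv ℝ z y v = 0 → fderiv ℝ l y v = α y v := by
  set lam := fderiv ℝ z a with hlam
  obtain ⟨v₀, hv₀⟩ : ∃ v, lam v = 1 := by
    obtain ⟨v, hv⟩ : ∃ v, lam v ≠ 0 := by
      by_contra! h
      exact hz0 (ContinuousLinearMap.ext h)
    exact ⟨(lam v)⁻¹ • v, by simp [hv]⟩
  -- Since `lam v₀ = 1`, this map satisfies `lam ∘ Φ = z`, and its derivative at `a` is the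
  -- identity. It carries the levels of `z` to those of `lam`, where the fibrewise lemma applies.
  set Φ : E → E := fun x => x + (z x - lam x) • v₀ with hΦ
  have hΦs : ∀ᶠ y in 𝓝 a, ContDiffAt ℝ ∞ Φ y := by
    filter_upwards [hz] with y hy
    exact contDiffAt_id.add ((hy.sub lam.contDiff.contDiffAt).smul contDiffAt_const)
  have hΦd : ∀ y, ContDiffAt ℝ ∞ z y →
      HasFDerivAt Φ (.id ℝ E + (fderiv ℝ z y - lam).smulRight v₀) y := fun y hy =>
    (hasFDerivAt_id y).add
      (((hy.differentiableAt (by simp)).hasFDerivAt.sub lam.hasFDerivAt).smul_const v₀)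
  have hlΦ : ∀ x, lam (Φ x) = z x := fun x => by simp [hΦ, hv₀]
  obtain ⟨ψ, haψ, hψU, hψ, hψs, hψt⟩ := exists_smooth_openPartialHomeomorph
    (inter_mem (inter_mem hz hα) hclosed) hΦs (.refl ℝ E) (by
      rw [(hΦd a hz.self_of_nhds).fderiv, ← hlam]
      ext v
      simp)
  have hsrc : ∀ y ∈ ψ.target, ContDiffAt ℝ ∞ z (ψ.symm y) ∧ ContDiffAt ℝ ∞ α (ψ.symm y) ∧
      ∀ v w, fderiv ℝ z (ψ.symm y) v = 0 → fderiv ℝ z (ψ.symm y) w = 0 →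
        fderiv ℝ α (ψ.symm y) v w = fderiv ℝ α (ψ.symm y) w v := fun y hy =>
    have h := hψU (ψ.map_target hy)
    ⟨h.1.1, h.1.2, h.2⟩
  have hker : ∀ y ∈ ψ.target, ∀ v, fderiv ℝ z (ψ.symm y) (fderiv ℝ ψ.symm y v) = lam v := by
    intro y hy v
    have h1 : (fun w => z (ψ.symm w)) =ᶠ[𝓝 y] lam := by
      filter_upwards [ψ.open_target.mem_nhds hy] with w hw
      rw [← hlΦ, ← hψ, ψ.right_inv hw]
    have h2 := ((hsrc y hy).1.differentiableAt (by simp)).hasFDerivAt.comp y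
      ((hψt y hy).differentiableAt (by simp)).hasFDerivAt
    have h3 := h2.unique (lam.hasFDerivAt.congr_of_eventuallyEq h1)
    exact DFunLike.congr_fun h3 v
  obtain ⟨l, hl, hlα⟩ := exists_primitive_along_ker lam
    (α := fun y => (α (ψ.symm y)).comp (fderiv ℝ ψ.symm y)) (b := Φ a) (by
      filter_upwards [ψ.open_target.mem_nhds (hψ ▸ ψ.map_source haψ)] with y hy
      exact ((hsrc y hy).2.1.comp y (hψt y hy)).clm_comp ((hψt y hy).fderiv_right (m := ∞) (by simp))) (by
      filter_upwards [ψ.open_target.mem_nhds (hψ ▸ ψ.map_source haψ)] with y hy v w hv hw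
      have h1 := ((hsrc y hy).2.1.differentiableAt (by simp)).hasFDerivAt.comp y
        ((hψt y hy).differentiableAt (by simp)).hasFDerivAt
      have h2 : HasFDerivAt (fderiv ℝ ψ.symm) (fderiv ℝ (fderiv ℝ ψ.symm) y) y :=
        (((hψt y hy).fderiv_right (m := ∞) (by simp)).differentiableAt (by simp)).hasFDerivAt
      have h3 : fderiv ℝ (fun y => (α (ψ.symm y)).comp (fderiv ℝ ψ.symm y)) y = _ :=
        (h1.clm_comp h2).fderiv
      -- The pullback of `α` stays closed along the fibres: the extra term contains the second
      -- derivative of `ψ.symm` and cancels by symmetry.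
      have h4 := (hψt y hy).isSymmSndFDerivAt (by
        rw [minSmoothness_of_isRCLikeNormedField]; exact WithTop.coe_le_coe.2 le_top) v w
      have h5 := (hsrc y hy).2.2 (fderiv ℝ ψ.symm y v) (fderiv ℝ ψ.symm y w)
        (by rw [hker y hy, hv]) (by rw [hker y hy, hw])
      rw [h3]
      simp [h4, h5])
  have hcont : Tendsto Φ (𝓝 a) (𝓝 (Φ a)) := hΦs.self_of_nhds.continuousAt
  refine ⟨l ∘ Φ, ?_, ?_⟩
  · filter_upwards [hcont.eventually hl, hΦs] with y h1 h2
    exact h1.comp y h2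
  · filter_upwards [hcont.eventually hl, hcont.eventually hlα, hz,
      ψ.open_source.mem_nhds haψ] with y h1 h2 h3 hy v hv
    have h4 := (h1.differentiableAt (by simp)).hasFDerivAt.comp y (hΦd y h3)
    have h5 : lam (v + (fderiv ℝ z y v - lam v) • v₀) = 0 := by simp [hv₀, hv]
    have hyt : Φ y ∈ ψ.target := hψ ▸ ψ.map_source hy
    have hsymm : ψ.symm (Φ y) = y := by rw [← hψ, ψ.left_inv hy]
    have h6 : HasFDerivAt (fun w => ψ.symm (Φ w)) (.id ℝ E) y := by
      refine (hasFDerivAt_id y).congr_of_eventuallyEq ?_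
      filter_upwards [ψ.open_source.mem_nhds hy] with w hw
      rw [← hψ, ψ.left_inv hw, id]
    have h7 := ((hψt _ hyt).differentiableAt (by simp)).hasFDerivAt.comp y (hΦd y h3)
    have h8 := DFunLike.congr_fun (h7.unique h6) v
    rw [h4.fderiv]
    have h9 := h2 _ h5
    simp only [ContinuousLinearMap.comp_apply, hsymm] at h8 h9 ⊢
    simp only [add_apply, ContinuousLinearMap.smulRight_apply,
      sub_apply, ContinuousLinearMap.id_apply] at h8 ⊢
    rw [h9, h8]

/-- Straightening of a coframe `α` with `dαᵢ = βᵢ ∧ α₀` and `β₀` exact. -/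
theorem exists_straightening_of_coframe {E : Type} [NormedAddCommGroup E]
    [NormedSpace ℝ E] [FiniteDimensional ℝ E] {α β : Fin 3 → E → E →L[ℝ] ℝ} {G : E → ℝ} {a : E}
    (hdim : Module.finrank ℝ E = 3) {U : Set E} (hU : U ∈ 𝓝 a)
    (hα : ∀ i, ∀ᶠ y in 𝓝 a, ContDiffAt ℝ ∞ (α i) y) (hG : ∀ᶠ y in 𝓝 a, ContDiffAt ℝ ∞ G y)
    (hker : ∀ v, (∀ i, α i a v = 0) → v = 0)
    (hβ : ∀ᶠ y in 𝓝 a, β 0 y = fderiv ℝ G y)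
    (hd : ∀ i, ∀ᶠ y in 𝓝 a, ∀ v w, fderiv ℝ (α i) y v w - fderiv ℝ (α i) y w v
      = β i y v * α 0 y w - β i y w * α 0 y v) :
    ∃ ψ : OpenPartialHomeomorph E (ℝ × ℝ × ℝ), a ∈ ψ.source ∧ ψ.source ⊆ U ∧
      (∀ y ∈ ψ.source, ContDiffAt ℝ ∞ ψ y) ∧ (∀ y ∈ ψ.target, ContDiffAt ℝ ∞ ψ.symm y) ∧
      ∀ y ∈ ψ.source, ∀ v, α 0 y v = 0 → fderiv ℝ ψ y v = (0, α 1 y v, α 2 y v) := by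
  -- The integrating factor: dη = exp(-G) (dα₀ - dG ∧ α₀) = 0.
  set η : E → E →L[ℝ] ℝ := fun y => Real.exp (-G y) • α 0 y with hη
  have hηs : ∀ᶠ y in 𝓝 a, ContDiffAt ℝ ∞ η y := by
    filter_upwards [hG, hα 0] with y h1 h2
    exact h1.neg.exp.smul h2
  have hηc : ∀ᶠ y in 𝓝 a, ∀ v w, fderiv ℝ η y v w = fderiv ℝ η y w v := by
    filter_upwards [hG, hα 0, hβ, hd 0] with y h1 h2 h3 h4 v w
    have h5 : fderiv ℝ η y = _ := (((h1.differentiableAt (by simp)).hasFDerivAt.neg.exp).smul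
      (h2.differentiableAt (by simp)).hasFDerivAt).fderiv
    rw [h5]
    have h6 := h4 v w
    rw [h3] at h6
    simp
    linear_combination Real.exp (-G y) * h6
  obtain ⟨r, hr, hball⟩ := Metric.eventually_nhds_iff_ball.1 (hηs.and hηc)
  obtain ⟨z, hz⟩ := (convex_ball a r).exists_forall_hasFDerivAt_of_fderiv_symmetric
    Metric.isOpen_ball
    (fun y hy => ((hball y hy).1.differentiableAt (by simp)).differentiableWithinAt)
    (fun y hy => (hball y hy).2)
  have hzs : ∀ y ∈ Metric.ball a r, ContDiffAt ℝ ∞ z y := by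
    have : ContDiffOn ℝ ∞ z (Metric.ball a r) := by
      rw [contDiffOn_infty_iff_fderiv_of_isOpen Metric.isOpen_ball]
      refine ⟨fun y hy => (hz y hy).differentiableAt.differentiableWithinAt, ?_⟩
      exact ContDiffOn.congr (fun y hy => (hball y hy).1.contDiffWithinAt)
        fun y hy => (hz y hy).fderiv
    exact fun y hy => this.contDiffAt (Metric.isOpen_ball.mem_nhds hy)
  have hzn : ∀ᶠ y in 𝓝 a, ContDiffAt ℝ ∞ z y ∧ fderiv ℝ z y = η y := by
    filter_upwards [Metric.ball_mem_nhds a hr] with y hy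
    exact ⟨hzs y hy, (hz y hy).fderiv⟩
  have hzker : ∀ᶠ y in 𝓝 a, ∀ v, fderiv ℝ z y v = 0 ↔ α 0 y v = 0 := by
    filter_upwards [hzn] with y hy v
    simp [hy.2, hη]
  -- Otherwise `α 1` and `α 2` alone would embed a three-dimensional space into ℝ².
  have hα0 : α 0 a ≠ 0 := by
    intro h0
    have : Function.Injective (((α 1 a).prod (α 2 a)) : E →ₗ[ℝ] ℝ × ℝ) := by
      rw [← LinearMap.ker_eq_bot, LinearMap.ker_eq_bot']
      intro v hv
      simp only [ContinuousLinearMap.coe_coe, ContinuousLinearMap.prod_apply,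
        Prod.mk_eq_zero] at hv
      refine hker v fun i => ?_
      fin_cases i
      · simp [h0]
      · exact hv.1
      · exact hv.2
    have := LinearMap.finrank_le_finrank_of_injective this
    simp [hdim] at this
  have hl : ∀ i, ∃ l : E → ℝ, (∀ᶠ y in 𝓝 a, ContDiffAt ℝ ∞ l y) ∧
      ∀ᶠ y in 𝓝 a, ∀ v, fderiv ℝ z y v = 0 → fderiv ℝ l y v = α i y v := by
    intro i
    refine exists_primitive_along_levels (hzn.mono fun _ h => h.1) ?_ (hα i) ?_
    · rw [hzn.self_of_nhds.2]
      simp [hη, hα0]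
    · filter_upwards [hzker, hd i] with y h1 h2 v w hv hw
      have := h2 v w
      rw [(h1 v).1 hv, (h1 w).1 hw] at this
      linarith
  obtain ⟨l₁, hl₁, hl₁'⟩ := hl 1
  obtain ⟨l₂, hl₂, hl₂'⟩ := hl 2
  set Φ : E → ℝ × ℝ × ℝ := fun y => (z y, l₁ y, l₂ y) with hΦ
  have hΦs : ∀ᶠ y in 𝓝 a, ContDiffAt ℝ ∞ Φ y := by
    filter_upwards [hzn, hl₁, hl₂] with y h1 h2 h3
    exact h1.1.prodMk (h2.prodMk h3)
  have hΦd : ∀ᶠ y in 𝓝 a, ∀ v, fderiv ℝ Φ y v = (fderiv ℝ z y v, fderiv ℝ l₁ y v,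
      fderiv ℝ l₂ y v) := by
    filter_upwards [hzn, hl₁, hl₂] with y h1 h2 h3 v
    have : HasFDerivAt Φ _ y := (h1.1.differentiableAt (by simp)).hasFDerivAt.prodMk
      ((h2.differentiableAt (by simp)).hasFDerivAt.prodMk
        (h3.differentiableAt (by simp)).hasFDerivAt)
    rw [this.fderiv]
    rfl
  have hinj : Function.Injective (fderiv ℝ Φ a : E →ₗ[ℝ] ℝ × ℝ × ℝ) := by
    rw [← LinearMap.ker_eq_bot, LinearMap.ker_eq_bot']
    intro v hv
    rw [ContinuousLinearMap.coe_coe, hΦd.self_of_nhds v] at hv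
    simp only [Prod.mk_eq_zero] at hv
    refine hker v fun i => ?_
    fin_cases i
    · exact (hzker.self_of_nhds v).1 hv.1
    · exact (hl₁'.self_of_nhds v hv.1).symm.trans hv.2.1
    · exact (hl₂'.self_of_nhds v hv.1).symm.trans hv.2.2
  set L := (LinearEquiv.ofInjectiveOfFinrankEq _ hinj (by simp [hdim])).toContinuousLinearEquiv
  obtain ⟨ψ, h1, h2, h3, h4, h5⟩ := exists_smooth_openPartialHomeomorph
    (inter_mem hU (inter_mem hΦd (inter_mem hzker (inter_mem hl₁' hl₂')))) hΦs L rfl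
  refine ⟨ψ, h1, fun y hy => (h2 hy).1, h3 ▸ h4, h5, fun y hy v hv => ?_⟩
  obtain ⟨-, e1, e2, e3, e4⟩ := h2 hy
  have hv' := (e2 v).2 hv
  rw [h3, e1 v, hv', e3 v hv', e4 v hv']

end

/-! ### Smoothness of the dual frame and structure equations -/

section

/-- The solution of a linear system with smooth coefficients is smooth. -/
theorem contMDiffAt_of_clm_apply_eq_const {E F : Type*} [NormedAddCommGroup E] [NormedSpace ℝ E]
    [CompleteSpace E] [NormedAddCommGroup F] [NormedSpace ℝ F]
    {H : Type*} [TopologicalSpace H] {E' : Type*} [NormedAddCommGroup E'] [NormedSpace ℝ E']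
    {I : ModelWithCorners ℝ E' H} {M : Type*} [TopologicalSpace M] [ChartedSpace H M]
    {A : M → E →L[ℝ] F} {v : M → E} {c : F} {x₀ : M}
    (hA : ContMDiffAt I 𝓘(ℝ, E →L[ℝ] F) ∞ A x₀) (L : E ≃L[ℝ] F) (hL : A x₀ = L)
    (hv : ∀ᶠ x in 𝓝 x₀, A x (v x) = c) : ContMDiffAt I 𝓘(ℝ, E) ∞ v x₀ := by
  have h1 : ContMDiffAt I 𝓘(ℝ, F →L[ℝ] E) ∞ (fun x => (A x).inverse) x₀ := by
    have : ContDiffAt ℝ ∞ (ContinuousLinearMap.inverse : (E →L[ℝ] F) → (F →L[ℝ] E)) (A x₀) :=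
      hL ▸ contDiffAt_map_inverse L
    exact this.contMDiffAt.comp x₀ hA
  have h2 : ContMDiffAt I 𝓘(ℝ, E) ∞ (fun x => (A x).inverse c) x₀ :=
    h1.clm_apply contMDiffAt_const
  refine h2.congr_of_eventuallyEq ?_
  have h3 : ∀ᶠ x in 𝓝 x₀, A x ∈ range ((↑) : (E ≃L[ℝ] F) → (E →L[ℝ] F)) :=
    hA.continuousAt.eventually (hL ▸ L.nhds)
  filter_upwards [hv, h3] with x hx ⟨N, hN⟩
  rw [← hx, ← hN, ContinuousLinearMap.inverse_equiv]
  simp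

/-- The solution of a square linear system with smooth coefficients is smooth. -/
theorem contMDiffAt_of_forall_clm_apply_eq {E : Type*} [NormedAddCommGroup E] [NormedSpace ℝ E]
    [FiniteDimensional ℝ E] {n : ℕ} (hn : Module.finrank ℝ E = n)
    {H : Type*} [TopologicalSpace H] {E' : Type*} [NormedAddCommGroup E'] [NormedSpace ℝ E']
    {I : ModelWithCorners ℝ E' H} {M : Type*} [TopologicalSpace M] [ChartedSpace H M]
    {f : Fin n → M → E →L[ℝ] ℝ} {v : M → E} {c : Fin n → ℝ} {x₀ : M}
    (hf : ∀ i, ContMDiffAt I 𝓘(ℝ, E →L[ℝ] ℝ) ∞ (f i) x₀)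
    (hinj : ∀ w, (∀ i, f i x₀ w = 0) → w = 0)
    (hv : ∀ᶠ x in 𝓝 x₀, ∀ i, f i x (v x) = c i) : ContMDiffAt I 𝓘(ℝ, E) ∞ v x₀ := by
  -- Written as a sum of fixed continuous linear images of the `f i x`, the matrix of the system
  -- visibly depends smoothly on `x`.
  have hexp : ∀ x, ContinuousLinearMap.pi (fun i => f i x) = ∑ i,
      (ContinuousLinearMap.smulRightL ℝ E (Fin n → ℝ)).flip (Pi.single i 1) (f i x) := by
    intro x
    ext w i
    simp [Finset.sum_apply, Pi.single_apply]
  have hA : ContMDiffAt I 𝓘(ℝ, E →L[ℝ] (Fin n → ℝ)) ∞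
      (fun x => ContinuousLinearMap.pi fun i => f i x) x₀ := by
    simp_rw [hexp]
    exact ContMDiffAt.sum fun i _ => (ContinuousLinearMap.contMDiff
      ((ContinuousLinearMap.smulRightL ℝ E (Fin n → ℝ)).flip (Pi.single i 1))).contMDiffAt.comp x₀
        (hf i)
  have hinj' : Function.Injective
      ((ContinuousLinearMap.pi fun i => f i x₀ : E →L[ℝ] (Fin n → ℝ)) : E →ₗ[ℝ] (Fin n → ℝ)) := by
    rw [← LinearMap.ker_eq_bot, LinearMap.ker_eq_bot']
    exact fun w hw => hinj w fun i => congrFun hw i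
  refine contMDiffAt_of_clm_apply_eq_const hA
    (LinearEquiv.ofInjectiveOfFinrankEq _ hinj' (by simp [hn])).toContinuousLinearEquiv rfl
    (c := c) ?_
  filter_upwards [hv] with x hx
  exact funext hx

variable {S : Type*} [TopologicalSpace S] [ChartedSpace E3 S] [IsManifold (𝓡 3) ∞ S]

namespace CauchyPair

theorem eq_zero_of_forall (P : CauchyPair S) {x : S} {v : TangentSpace (𝓡 3) x}
    (h : ∀ i, P.e i x v = 0) : v = 0 :=
  (P.coord_bijective x).1 (by rw [map_zero]; exact funext h)

theorem eq_sum_sharp (P : CauchyPair S) (x : S) (v : TangentSpace (𝓡 3) x) :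
    v = ∑ i, P.e i x v • P.sharp i x := by
  rw [← sub_eq_zero]
  refine P.eq_zero_of_forall fun j => ?_
  rw [map_sub, map_sum]
  simp [e_sharp]

/-- In a trivialization the field solves the linear system e_i(X) = δ_ij, whose coefficients are
smooth. -/
theorem isSmooth_sharp (P : CauchyPair S) (j : Fin 3) : IsSmoothVField (P.sharp j) := by
  intro x₀
  rw [Bundle.contMDiffAt_section]
  set t := trivializationAt E3 (TangentSpace (𝓡 3) : S → Type _) x₀ with ht
  have hx₀ : x₀ ∈ t.baseSet := FiberBundle.mem_baseSet_trivializationAt' x₀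
  refine contMDiffAt_of_forall_clm_apply_eq (n := 3) (by simp)
    (f := fun i x => (P.e i x).comp (t.symmL ℝ x)) (c := Pi.single j 1) (fun i => ?_) ?_ ?_
  · have := (contMDiffAt_hom_bundle (F₁ := E3) (E₁ := (TangentSpace (𝓡 3) : S → Type _))
      (F₂ := ℝ) (E₂ := Bundle.Trivial S ℝ) _).1 (P.e_smooth i x₀)
    refine this.2.congr_of_eventuallyEq ?_
    filter_upwards [t.open_baseSet.mem_nhds hx₀] with x hx
    ext v
    simp [ContinuousLinearMap.inCoordinates, t]
  · intro w hw
    have h1 : t.symmL ℝ x₀ w = 0 := P.eq_zero_of_forall hw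
    rw [← t.continuousLinearMapAt_symmL (R := ℝ) hx₀ w, h1, map_zero]
  · filter_upwards [t.open_baseSet.mem_nhds hx₀] with x hx i
    rw [← t.continuousLinearMapAt_apply_of_mem (R := ℝ) hx, ContinuousLinearMap.comp_apply,
      t.symmL_continuousLinearMapAt hx, e_sharp, Pi.single_apply]

theorem mdifferentiableAt_sharp (P : CauchyPair S) (j : Fin 3) (x : S) :
    MDifferentiableAt (𝓡 3) ((𝓡 3).prod 𝓘(ℝ, E3))
      (fun x => (Bundle.TotalSpace.mk' E3 x (P.sharp j x) : TangentBundle (𝓡 3) S)) x :=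
  (P.isSmooth_sharp j x).mdifferentiableAt (by simp)

/-- The structure equations of the frame. -/
theorem IsParallel.e_mlieBracket {P : CauchyPair S} (h : P.IsParallel) (i j k : Fin 3) (x : S) :
    P.e k x (VectorField.mlieBracket (𝓡 3) (P.sharp i) (P.sharp j) x)
      = P.thE k x (P.sharp j x) * P.e 0 x (P.sharp i x)
        - P.thE k x (P.sharp i x) * P.e 0 x (P.sharp j x) := by
  have h1 := h.ext_eq k _ _ (P.isSmooth_sharp i) (P.isSmooth_sharp j) x
  simp only [extD, wedge, e_sharp] at h1 ⊢
  rw [mvfderiv_const, mvfderiv_const] at h1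
  simp only [zero_apply] at h1
  linarith

/-- Both fields lie in ker e_u, and each structure equation has e_u as a factor on the right. -/
theorem IsParallel.mlieBracket_eq_zero {P : CauchyPair S} (h : P.IsParallel) (x : S) :
    VectorField.mlieBracket (𝓡 3) (P.sharp 1) (P.sharp 2) x = 0 :=
  P.eq_zero_of_forall fun i => by simp [h.e_mlieBracket, e_sharp]

end CauchyPair

end

/-! ### The coframe and its structure equations in a parametrisation -/

section

theorem contDiff_clm_eval {E : Type*} [NormedAddCommGroup E] [NormedSpace ℝ E] :
    ContDiff ℝ ∞ (fun v : E => (ContinuousLinearMap.apply ℝ ℝ v : (E →L[ℝ] ℝ) →L[ℝ] ℝ)) := by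
  fun_prop

variable {S : Type*} [TopologicalSpace S] [ChartedSpace E3 S] [IsManifold (𝓡 3) ∞ S]

namespace CauchyPair

/-- A pointwise family of covectors of `S` along a map from the model space, pulled back. -/
noncomputable def pullCovec (f : E3 → S) (a : OneForm S) (y : E3) : E3 →L[ℝ] ℝ :=
  (a (f y)).comp (mfderiv 𝓘(ℝ, E3) (𝓡 3) f y)

/-- The frame pulled back to the model space. -/
noncomputable def pullFrame (P : CauchyPair S) (f : E3 → S) (i : Fin 3) : E3 → E3 :=
  VectorField.mpullback 𝓘(ℝ, E3) (𝓡 3) f (P.sharp i)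

section

variable (P : CauchyPair S) {f : E3 → S} {y : E3}

theorem mfderiv_pullFrame (hf' : (mfderiv 𝓘(ℝ, E3) (𝓡 3) f y).IsInvertible) (i : Fin 3) :
    mfderiv 𝓘(ℝ, E3) (𝓡 3) f y (P.pullFrame f i y) = P.sharp i (f y) := by
  rw [pullFrame, VectorField.mpullback_apply]
  exact hf'.self_apply_inverse _

theorem pullCovec_pullFrame (hf' : (mfderiv 𝓘(ℝ, E3) (𝓡 3) f y).IsInvertible) (a : OneForm S)
    (i : Fin 3) : pullCovec f a y (P.pullFrame f i y) = a (f y) (P.sharp i (f y)) := by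
  rw [← P.mfderiv_pullFrame hf']
  rfl

theorem eq_zero_of_pullCovec (hf' : (mfderiv 𝓘(ℝ, E3) (𝓡 3) f y).IsInvertible) {v : E3}
    (h : ∀ i, pullCovec f (P.e i) y v = 0) : v = 0 := by
  have h1 : mfderiv 𝓘(ℝ, E3) (𝓡 3) f y v = 0 := P.eq_zero_of_forall h
  exact hf'.injective (h1.trans (map_zero _).symm)

theorem eq_sum_pullFrame (hf' : (mfderiv 𝓘(ℝ, E3) (𝓡 3) f y).IsInvertible) (v : E3) :
    v = ∑ i, pullCovec f (P.e i) y v • P.pullFrame f i y := by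
  rw [← sub_eq_zero]
  refine P.eq_zero_of_pullCovec hf' fun j => ?_
  rw [map_sub, map_sum]
  simp [P.pullCovec_pullFrame hf', e_sharp]

theorem contDiffAt_pullFrame (hf : ContMDiffAt 𝓘(ℝ, E3) (𝓡 3) ∞ f y)
    (hf' : (mfderiv 𝓘(ℝ, E3) (𝓡 3) f y).IsInvertible) (i : Fin 3) :
    ContDiffAt ℝ ∞ (P.pullFrame f i) y := by
  exact contMDiffAt_vectorSpace_iff_contDiffAt.1
    (ContMDiffAt.mpullback_vectorField_preimage (P.isSmooth_sharp i (f y)) hf hf' (by simp))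

/-- By duality: the covector is determined by its constant values on the pulled-back frame, which is
already known to be smooth. -/
theorem contDiffAt_pullCovec (hf : ∀ᶠ y in 𝓝 y, ContMDiffAt 𝓘(ℝ, E3) (𝓡 3) ∞ f y ∧
    (mfderiv 𝓘(ℝ, E3) (𝓡 3) f y).IsInvertible) (i : Fin 3) :
    ContDiffAt ℝ ∞ (pullCovec f (P.e i)) y := by
  have hfin : Module.finrank ℝ (E3 →L[ℝ] ℝ) = 3 := by
    rw [← (LinearMap.toContinuousLinearMap (𝕜 := ℝ) (E := E3) (F' := ℝ)).finrank_eq]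
    exact Subspace.dual_finrank_eq.trans finrank_euclideanSpace_fin
  rw [← contMDiffAt_iff_contDiffAt]
  refine contMDiffAt_of_forall_clm_apply_eq (n := 3)
    hfin (f := fun j y => ContinuousLinearMap.apply ℝ ℝ (P.pullFrame f j y)) (c := Pi.single i 1)
    (fun j => ?_) (fun w hw => ?_) ?_
  · rw [contMDiffAt_iff_contDiffAt]
    exact contDiff_clm_eval.contDiffAt.comp y
      (P.contDiffAt_pullFrame hf.self_of_nhds.1 hf.self_of_nhds.2 j)
  · ext1 v
    rw [P.eq_sum_pullFrame hf.self_of_nhds.2 v, map_sum]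
    simp only [map_smul]
    exact Finset.sum_eq_zero fun j _ => by rw [show w (P.pullFrame f j y) = 0 from hw j, smul_zero]
  · filter_upwards [hf] with x hx j
    rw [ContinuousLinearMap.apply_apply, P.pullCovec_pullFrame hx.2, e_sharp, Pi.single_apply]
    simp only [eq_comm]

theorem lieBracket_pullFrame (hf : ContMDiffAt 𝓘(ℝ, E3) (𝓡 3) ∞ f y) (i j : Fin 3) :
    VectorField.lieBracket ℝ (P.pullFrame f i) (P.pullFrame f j) y =
      VectorField.mpullback 𝓘(ℝ, E3) (𝓡 3) f
        (VectorField.mlieBracket (𝓡 3) (P.sharp i) (P.sharp j)) y := by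
  have hle : minSmoothness ℝ 2 ≤ (∞ : ℕ∞ω) := by
    rw [minSmoothness_of_isRCLikeNormedField]
    exact WithTop.coe_le_coe.2 le_top
  have : IsManifold (𝓡 3) (minSmoothness ℝ 2) S := .of_le (n := ∞) hle
  rw [VectorField.mpullback_mlieBracket (n := ∞) (P.mdifferentiableAt_sharp i _)
    (P.mdifferentiableAt_sharp j _) hf hle,
    ← VectorField.mlieBracketWithin_univ, VectorField.mlieBracketWithin_eq_lieBracketWithin]
  exact congrFun (VectorField.lieBracketWithin_univ (𝕜 := ℝ) (V := P.pullFrame f i)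
    (W := P.pullFrame f j)).symm y

/-- The structure equations of a parallel Cauchy pair read in a parametrisation. -/
theorem IsParallel.fderiv_pullCovec {P : CauchyPair S} (hP : P.IsParallel)
    (hf : ∀ᶠ y in 𝓝 y, ContMDiffAt 𝓘(ℝ, E3) (𝓡 3) ∞ f y ∧
      (mfderiv 𝓘(ℝ, E3) (𝓡 3) f y).IsInvertible) (k : Fin 3) (v w : E3) :
    fderiv ℝ (pullCovec f (P.e k)) y v w - fderiv ℝ (pullCovec f (P.e k)) y w v
      = pullCovec f (P.thE k) y v * pullCovec f (P.e 0) y w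
        - pullCovec f (P.thE k) y w * pullCovec f (P.e 0) y v := by
  have hf0 := hf.self_of_nhds
  have hα : HasFDerivAt (pullCovec f (P.e k)) (fderiv ℝ (pullCovec f (P.e k)) y) y :=
    ((P.contDiffAt_pullCovec hf k).differentiableAt (by simp)).hasFDerivAt
  have hX : ∀ i, HasFDerivAt (P.pullFrame f i) (fderiv ℝ (P.pullFrame f i) y) y := fun i =>
    ((P.contDiffAt_pullFrame hf0.1 hf0.2 i).differentiableAt (by simp)).hasFDerivAt
  -- The product rule applied to the constant pairing of `e k` with the `j`-th frame field.
  have hconst : ∀ j u, fderiv ℝ (pullCovec f (P.e k)) y u (P.pullFrame f j y) =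
      - pullCovec f (P.e k) y (fderiv ℝ (P.pullFrame f j) y u) := by
    intro j u
    have h1 := hα.clm_apply (hX j)
    have h2 : HasFDerivAt (fun y : E3 => pullCovec f (P.e k) y (P.pullFrame f j y)) (0 : E3 →L[ℝ] ℝ) y := by
      refine (hasFDerivAt_const (if k = j then (1 : ℝ) else 0) y).congr_of_eventuallyEq ?_
      filter_upwards [hf] with x hx
      rw [P.pullCovec_pullFrame hx.2, e_sharp]
    have h3 := DFunLike.congr_fun (h1.unique h2) u
    simp at h3
    linarith
  -- On frame vectors the antisymmetrised derivative is minus the pairing with the Lie bracket; the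
  -- general case follows by bilinearity.
  have hframe : ∀ i j, fderiv ℝ (pullCovec f (P.e k)) y (P.pullFrame f i y) (P.pullFrame f j y)
      - fderiv ℝ (pullCovec f (P.e k)) y (P.pullFrame f j y) (P.pullFrame f i y)
      = pullCovec f (P.thE k) y (P.pullFrame f i y) * pullCovec f (P.e 0) y (P.pullFrame f j y)
      - pullCovec f (P.thE k) y (P.pullFrame f j y) * pullCovec f (P.e 0) y (P.pullFrame f i y) := by
    intro i j
    have h1 : pullCovec f (P.e k) y
        (VectorField.lieBracket ℝ (P.pullFrame f i) (P.pullFrame f j) y) = P.e k (f y)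
        (VectorField.mlieBracket (𝓡 3) (P.sharp i) (P.sharp j) (f y)) := by
      rw [P.lieBracket_pullFrame hf0.1, VectorField.mpullback_apply]
      exact congrArg (P.e k (f y)) (hf0.2.self_apply_inverse _)
    rw [hP.e_mlieBracket, VectorField.lieBracket, map_sub] at h1
    simp only [P.pullCovec_pullFrame hf0.2, hconst]
    linarith
  have hv := P.eq_sum_pullFrame hf0.2 v
  have hw := P.eq_sum_pullFrame hf0.2 w
  set a := fun i => pullCovec f (P.e i) y v
  set b := fun i => pullCovec f (P.e i) y w
  change v = ∑ i, a i • P.pullFrame f i y at hv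
  change w = ∑ i, b i • P.pullFrame f i y at hw
  -- The coefficients depend on `v` and `w`; making them opaque lets the expansions be substituted
  -- once.
  clear_value a b
  rw [hv, hw]
  simp only [Fin.sum_univ_three, map_add, map_smul, add_apply, smul_apply, smul_eq_mul]
  linear_combination a 0 * b 0 * hframe 0 0 + a 0 * b 1 * hframe 0 1 + a 0 * b 2 * hframe 0 2 + a 1 * b 0 * hframe 1 0 +
    a 1 * b 1 * hframe 1 1 + a 1 * b 2 * hframe 1 2 +
    a 2 * b 0 * hframe 2 0 + a 2 * b 1 * hframe 2 1 + a 2 * b 2 * hframe 2 2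

end

end CauchyPair

end

/-! ### Straightening charts on the manifold -/

section

variable {S : Type*} [TopologicalSpace S] [ChartedSpace E3 S] [IsManifold (𝓡 3) ∞ S]

namespace CauchyPair

/-- A chart in which `e_l^♯` and `e_n^♯` are the last two coordinate fields. -/
structure IsStraightening (P : CauchyPair S) (ψ : OpenPartialHomeomorph S (ℝ × ℝ × ℝ)) : Prop where
  contMDiffAt : ∀ x ∈ ψ.source, ContMDiffAt (𝓡 3) 𝓘(ℝ, ℝ × ℝ × ℝ) ∞ ψ x
  contMDiffAt_symm : ∀ y ∈ ψ.target, ContMDiffAt 𝓘(ℝ, ℝ × ℝ × ℝ) (𝓡 3) ∞ ψ.symm y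
  mfderiv_apply : ∀ x ∈ ψ.source, ∀ v, P.e 0 x v = 0 →
    mfderiv (𝓡 3) 𝓘(ℝ, ℝ × ℝ × ℝ) ψ x v = ((0, P.e 1 x v, P.e 2 x v) : ℝ × ℝ × ℝ)

theorem IsParallel.exists_isStraightening {P : CauchyPair S} (hP : P.IsParallel) (p : S) :
    ∃ ψ : OpenPartialHomeomorph S (ℝ × ℝ × ℝ), p ∈ ψ.source ∧ P.IsStraightening ψ := by
  set c := chartAt E3 p with hc
  have hcs : ContMDiffOn (𝓡 3) 𝓘(ℝ, E3) ∞ c c.source := contMDiffOn_chart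
  have hct : ContMDiffOn 𝓘(ℝ, E3) (𝓡 3) ∞ c.symm c.target := contMDiffOn_chart_symm
  have hcd : c.MDifferentiable (𝓡 3) 𝓘(ℝ, E3) := mdifferentiable_chart p
  have hpt : c p ∈ c.target := mem_chart_target E3 p
  have hinv : ∀ y ∈ c.target, (mfderiv 𝓘(ℝ, E3) (𝓡 3) c.symm y).IsInvertible := fun y hy =>
    ⟨hcd.symm.mfderiv hy, rfl⟩
  have hf : ∀ y ∈ c.target, ∀ᶠ y in 𝓝 y, ContMDiffAt 𝓘(ℝ, E3) (𝓡 3) ∞ c.symm y ∧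
      (mfderiv 𝓘(ℝ, E3) (𝓡 3) c.symm y).IsInvertible := fun y hy => by
    filter_upwards [c.open_target.mem_nhds hy] with w hw
    exact ⟨hct.contMDiffAt (c.open_target.mem_nhds hw), hinv w hw⟩
  have hnhds := c.open_target.mem_nhds hpt
  obtain ⟨F, hF, hFd⟩ := hP.exact_u
  obtain ⟨ψ, hpψ, hψU, hψ, hψs, hψd⟩ := exists_straightening_of_coframe
    (α := fun i => pullCovec c.symm (P.e i)) (β := fun i => pullCovec c.symm (P.thE i))
    (G := F ∘ c.symm) (a := c p) finrank_euclideanSpace_fin hnhds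
    (fun i => by
      filter_upwards [hnhds] with y hy
      exact P.contDiffAt_pullCovec (hf y hy) i)
    (by
      filter_upwards [hnhds] with y hy
      exact ((hF _).comp y (hf y hy).self_of_nhds.1).contDiffAt)
    (fun v hv => P.eq_zero_of_pullCovec (hinv _ hpt) hv)
    (by
      filter_upwards [hnhds] with y hy
      have h1 := mvfderiv_comp (g := F) y ((hF _).mdifferentiableAt (by simp))
        ((hf y hy).self_of_nhds.1.mdifferentiableAt (by simp))
      rw [pullCovec, hFd]
      refine h1.symm.trans ?_
      ext v
      simp [mvfderiv, mfderiv_eq_fderiv]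
      rfl)
    (fun i => by
      filter_upwards [hnhds] with y hy
      exact hP.fderiv_pullCovec (hf y hy) i)
  refine ⟨c.trans ψ, ⟨mem_chart_source E3 p, hpψ⟩, fun x hx => ?_, fun y hy => ?_, fun x hx v hv => ?_⟩
  · exact ((hψ _ hx.2).contMDiffAt).comp x (hcs.contMDiffAt (c.open_source.mem_nhds hx.1))
  · have h1 := (c.trans ψ).map_target hy
    have hy' : y ∈ ψ.target := hy.1
    have h2 : ψ.symm y ∈ c.target := hψU (ψ.map_target hy')
    exact (hct.contMDiffAt (c.open_target.mem_nhds h2)).comp y (hψs y hy').contMDiffAt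
  · have h1 : mfderiv (𝓡 3) 𝓘(ℝ, ℝ × ℝ × ℝ) (ψ ∘ c) x v = mfderiv 𝓘(ℝ, E3) 𝓘(ℝ, ℝ × ℝ × ℝ) ψ (c x)
        (mfderiv (𝓡 3) 𝓘(ℝ, E3) c x v) :=
      mfderiv_comp_apply x ((hψ _ hx.2).contMDiffAt.mdifferentiableAt (by simp))
        (hcd.mdifferentiableAt hx.1) v
    have h2 : ∀ i, pullCovec c.symm (P.e i) (c x) (mfderiv (𝓡 3) 𝓘(ℝ, E3) c x v) = P.e i x v := by
      intro i
      have h3 := DFunLike.congr_fun (hcd.symm_comp_deriv hx.1) v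
      have h4 : c.symm (c x) = x := c.left_inv hx.1
      -- The points `c.symm (c x)` and `x` are only propositionally equal, so the covector is
      -- transported along a variable base point.
      have h5 : ∀ y (hy : y = x) (w : E3), (w : TangentSpace (𝓡 3) x) = v →
        P.e i y w = P.e i x v := by
        rintro y rfl w rfl
        rfl
      exact h5 _ h4 _ h3
    have h3 := hψd (c x) hx.2 (mfderiv (𝓡 3) 𝓘(ℝ, E3) c x v) ((h2 0).trans hv)
    rw [h2, h2] at h3
    refine h1.trans ?_
    rw [mfderiv_eq_fderiv]
    exact h3

namespace IsStraightening

variable {P : CauchyPair S} {ψ : OpenPartialHomeomorph S (ℝ × ℝ × ℝ)}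

theorem mDifferentiable (h : P.IsStraightening ψ) : ψ.MDifferentiable (𝓡 3) 𝓘(ℝ, ℝ × ℝ × ℝ) :=
  ⟨fun x hx => ((h.contMDiffAt x hx).mdifferentiableAt (by simp)).mdifferentiableWithinAt,
    fun x hx => ((h.contMDiffAt_symm x hx).mdifferentiableAt (by simp)).mdifferentiableWithinAt⟩

theorem mfderiv_symm_apply (h : P.IsStraightening ψ) {x : S} (hx : x ∈ ψ.source) (a b : ℝ) :
    mfderiv 𝓘(ℝ, ℝ × ℝ × ℝ) (𝓡 3) ψ.symm (ψ x) ((0, a, b) : ℝ × ℝ × ℝ) =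
      (a • P.sharp 1 x + b • P.sharp 2 x : TangentSpace (𝓡 3) x) := by
  have h1 := h.mfderiv_apply x hx (a • P.sharp 1 x + b • P.sharp 2 x) (by simp [e_sharp])
  have h2 := DFunLike.congr_fun (h.mDifferentiable.symm_comp_deriv hx)
    (a • P.sharp 1 x + b • P.sharp 2 x)
  rw [ContinuousLinearMap.comp_apply, h1] at h2
  simp only [map_add, map_smul, e_sharp] at h2
  simpa using! h2

end IsStraightening

end CauchyPair

end

/-! ### Leaf fields: local integral curves and their length -/

section

variable {S : Type*} [TopologicalSpace S] [ChartedSpace E3 S] [IsManifold (𝓡 3) ∞ S]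

namespace CauchyPair

/-- The constant combinations of the frame fields tangent to `ker e_u`. -/
noncomputable def leafField (P : CauchyPair S) (a b : ℝ) : VField S := fun x => a • P.sharp 1 x + b • P.sharp 2 x

theorem leafField_one_zero (P : CauchyPair S) : P.leafField 1 0 = P.sharp 1 := by
  ext1 x
  simp [leafField]

theorem leafField_zero_one (P : CauchyPair S) : P.leafField 0 1 = P.sharp 2 := by
  ext1 x
  simp [leafField]

theorem isSmooth_leafField (P : CauchyPair S) (a b : ℝ) : IsSmoothVField (P.leafField a b) :=
  ((P.isSmooth_sharp 1).const_smul_section (a := a)).add_section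
    ((P.isSmooth_sharp 2).const_smul_section (a := b))

theorem contMDiff_leafField (P : CauchyPair S) (a b : ℝ) :
    ContMDiff (𝓡 3) (𝓡 3).tangent 1 (fun x => (⟨x, P.leafField a b x⟩ : TangentBundle (𝓡 3) S)) :=
  (P.isSmooth_leafField a b).of_le (by simp)

theorem metric_leafField (P : CauchyPair S) (a b : ℝ) (x : S) :
    P.metric x (P.leafField a b x) (P.leafField a b x) = a ^ 2 + b ^ 2 := by
  simp [metric, leafField, Fin.sum_univ_three, e_sharp]
  ring

theorem metric_smul (P : CauchyPair S) (c : ℝ) (x : S) (v : TangentSpace (𝓡 3) x) :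
    P.metric x (c • v) (c • v) = c ^ 2 * P.metric x v v := by
  simp only [metric, map_smul, smul_eq_mul, Finset.mul_sum]
  exact Finset.sum_congr rfl fun i _ => by ring

namespace IsStraightening

variable {P : CauchyPair S} {ψ : OpenPartialHomeomorph S (ℝ × ℝ × ℝ)}

theorem hasMFDerivAt_line (h : P.IsStraightening ψ) (c : ℝ × ℝ × ℝ) (a b : ℝ) {t : ℝ}
    (ht : c + t • (0, a, b) ∈ ψ.target) :
    HasMFDerivAt 𝓘(ℝ, ℝ) (𝓡 3) (fun t : ℝ => ψ.symm (c + t • ((0, a, b) : ℝ × ℝ × ℝ))) t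
      ((1 : ℝ →L[ℝ] ℝ).smulRight (P.leafField a b (ψ.symm (c + t • (0, a, b))))) := by
  have h1 : HasFDerivAt (fun t : ℝ => c + t • ((0, a, b) : ℝ × ℝ × ℝ))
      ((1 : ℝ →L[ℝ] ℝ).smulRight ((0, a, b) : ℝ × ℝ × ℝ)) t := by
    have := ((hasDerivAt_id t).smul_const ((0, a, b) : ℝ × ℝ × ℝ)).const_add c
    rw [one_smul] at this
    exact this.hasFDerivAt
  have h2 : HasMFDerivAt 𝓘(ℝ, ℝ × ℝ × ℝ) (𝓡 3) ψ.symm (c + t • (0, a, b)) _ :=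
    (h.mDifferentiable.mdifferentiableAt_symm ht).hasMFDerivAt
  have h3 := h2.comp t h1.hasMFDerivAt
  refine h3.congr_mfderiv ?_
  ext1
  have h4 := h.mfderiv_symm_apply (ψ.map_target ht) a b
  rw [ψ.right_inv ht] at h4
  exact (congrArg (mfderiv 𝓘(ℝ, ℝ × ℝ × ℝ) (𝓡 3) ψ.symm (c + t • (0, a, b)))
    (one_smul ℝ ((0, a, b) : ℝ × ℝ × ℝ))).trans (h4.trans (one_smul ℝ _).symm)

theorem isMIntegralCurveOn_line (h : P.IsStraightening ψ) (c : ℝ × ℝ × ℝ) (a b : ℝ) {s : Set ℝ}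
    (hs : ∀ t ∈ s, c + t • (0, a, b) ∈ ψ.target) :
    IsMIntegralCurveOn (I := 𝓡 3) (fun t : ℝ => ψ.symm (c + t • ((0, a, b) : ℝ × ℝ × ℝ)))
      (P.leafField a b) s :=
  fun t ht => (h.hasMFDerivAt_line c a b (hs t ht)).hasMFDerivWithinAt

end IsStraightening

namespace IsParallel

variable {P : CauchyPair S} (hP : P.IsParallel)

/-- In a straightening chart the integral curves are straight lines with one common direction, and
for starting points near `p` they stay in the chart for a common time. -/
theorem exists_uniform_time (hP : P.IsParallel) (a b : ℝ) (p : S) :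
    ∃ ε > 0, ∀ᶠ q in 𝓝 p, ∃ γ : ℝ → S, γ 0 = q ∧
      IsMIntegralCurveOn (I := 𝓡 3) γ (P.leafField a b) (Ioo (-ε) ε) := by
  obtain ⟨ψ, hpψ, hψ⟩ := hP.exists_isStraightening p
  have hc : ContinuousAt (fun z : S × ℝ => ψ z.1 + z.2 • ((0, a, b) : ℝ × ℝ × ℝ)) (p, 0) := by
    have h1 : ContinuousAt (fun z : S × ℝ => ψ z.1) (p, 0) :=
      (ψ.continuousAt hpψ).comp (x := ((p, 0) : S × ℝ)) continuousAt_fst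
    exact h1.add (by fun_prop)
  have h1 : ∀ᶠ z : S × ℝ in 𝓝 (p, 0), ψ z.1 + z.2 • ((0, a, b) : ℝ × ℝ × ℝ) ∈ ψ.target :=
    hc.eventually (by
      simp only [zero_smul, add_zero]
      exact ψ.open_target.mem_nhds (ψ.map_source hpψ))
  rw [nhds_prod_eq, eventually_prod_iff] at h1
  obtain ⟨A, hA, B, hB, hAB⟩ := h1
  obtain ⟨ε, hε, hεB⟩ := Metric.eventually_nhds_iff_ball.1 hB
  refine ⟨ε, hε, ?_⟩
  filter_upwards [hA, ψ.open_source.mem_nhds hpψ] with q hq hqψ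
  refine ⟨fun t => ψ.symm (ψ q + t • (0, a, b)), by simp [ψ.left_inv hqψ],
    hψ.isMIntegralCurveOn_line _ a b fun t ht => hAB hq (hεB t ?_)⟩
  rwa [Real.ball_eq_Ioo, zero_sub, zero_add]

/-- By local uniqueness the curve is a straight line in the chart. The regularity is needed to use
the curve as a competitor for the Riemannian distance. -/
theorem contMDiffAt_integralCurve [T2Space S] (hP : P.IsParallel) {a b : ℝ} {γ : ℝ → S} {t : ℝ}
    (hγ : IsMIntegralCurveAt (I := 𝓡 3) γ (P.leafField a b) t) :
    ContMDiffAt 𝓘(ℝ, ℝ) (𝓡 3) ∞ γ t := by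
  obtain ⟨ψ, hpψ, hψ⟩ := hP.exists_isStraightening (γ t)
  set c := ψ (γ t) - t • ((0, a, b) : ℝ × ℝ × ℝ) with hc
  have hct : c + t • ((0, a, b) : ℝ × ℝ × ℝ) = ψ (γ t) := by rw [hc, sub_add_cancel]
  have hcont : ContinuousAt (fun s : ℝ => c + s • ((0, a, b) : ℝ × ℝ × ℝ)) t := by fun_prop
  have h1 : ∀ᶠ s in 𝓝 t, c + s • ((0, a, b) : ℝ × ℝ × ℝ) ∈ ψ.target :=
    hcont.eventually (by simp only [hct]; exact ψ.open_target.mem_nhds (ψ.map_source hpψ))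
  have h2 := isMIntegralCurveAt_eventuallyEq_of_contMDiffAt_boundaryless
    (P.contMDiff_leafField a b _) hγ
    (γ' := fun s => ψ.symm (c + s • ((0, a, b) : ℝ × ℝ × ℝ)))
    (h1.mono fun s hs => hψ.hasMFDerivAt_line c a b hs) (by rw [hct, ψ.left_inv hpψ])
  refine ContMDiffAt.congr_of_eventuallyEq ?_ h2
  refine (hψ.contMDiffAt_symm _ h1.self_of_nhds).comp t (ContDiffAt.contMDiffAt ?_)
  fun_prop

/-- The speed is the constant √(a² + b²) ≤ 1, so the elapsed time bounds the length. -/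
theorem rDist_integralCurve_le [T2Space S] (hP : P.IsParallel) {a b : ℝ} (hab : a ^ 2 + b ^ 2 ≤ 1)
    {γ : ℝ → S} {s t : ℝ} (hst : s ≤ t) {J : Set ℝ} (hJ : IsOpen J) (hJst : Icc s t ⊆ J)
    (hγ : IsMIntegralCurveOn (I := 𝓡 3) γ (P.leafField a b) J) :
    P.rDist (γ s) (γ t) ≤ ENNReal.ofReal (t - s) ∧
      P.rDist (γ t) (γ s) ≤ ENNReal.ofReal (t - s) := by
  let _ : ∀ x : S, ENorm (TangentSpace (𝓡 3) x) :=
    fun x => ⟨fun v => ENNReal.ofReal (Real.sqrt (P.metric x v v))⟩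
  have _ : ∀ x : S, ENormSMulClass ℝ (TangentSpace (𝓡 3) x) := fun x => ⟨fun r v => by
    change ENNReal.ofReal (Real.sqrt (P.metric x (r • v) (r • v))) =
      ‖r‖ₑ * ENNReal.ofReal (Real.sqrt (P.metric x v v))
    rw [P.metric_smul, Real.sqrt_mul (sq_nonneg r), Real.sqrt_sq_eq_abs,
      ENNReal.ofReal_mul (abs_nonneg r), ← Real.norm_eq_abs, ofReal_norm]⟩
  have hγt : ∀ r ∈ Icc s t, IsMIntegralCurveAt (I := 𝓡 3) γ (P.leafField a b) r := fun r hr =>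
    hγ.isMIntegralCurveAt (hJ.mem_nhds (hJst hr))
  have h1 : Manifold.riemannianEDist (𝓡 3) (γ s) (γ t) ≤ Manifold.pathELength (𝓡 3) γ s t :=
    Manifold.riemannianEDist_le_pathELength
      (fun r hr => ((hP.contMDiffAt_integralCurve (hγt r hr)).of_le (by simp)).contMDiffWithinAt)
      rfl rfl hst
  suffices h2 : Manifold.pathELength (𝓡 3) γ s t ≤ ENNReal.ofReal (t - s) from
    ⟨h1.trans h2, Manifold.riemannianEDist_comm.trans_le (h1.trans h2)⟩
  rw [Manifold.pathELength_eq_lintegral_mfderiv_Icc]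
  calc ∫⁻ r in Icc s t, ‖mfderiv 𝓘(ℝ, ℝ) (𝓡 3) γ r 1‖ₑ ≤ ∫⁻ r in Icc s t, 1 := by
        refine MeasureTheory.setLIntegral_mono' measurableSet_Icc fun r hr => ?_
        rw [(hγt r hr).hasMFDerivAt.mfderiv]
        change ENNReal.ofReal (Real.sqrt (P.metric (γ r) ((1 : ℝ) • P.leafField a b (γ r))
          ((1 : ℝ) • P.leafField a b (γ r)))) ≤ 1
        rw [one_smul, P.metric_leafField]
        exact ENNReal.ofReal_le_one.2 (Real.sqrt_le_one.2 hab)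
    _ = ENNReal.ofReal (t - s) := by simp

end IsParallel

end CauchyPair

end

/-! ### Completeness of the leaf fields -/

section

variable {S : Type*} [TopologicalSpace S] [ChartedSpace E3 S] [IsManifold (𝓡 3) ∞ S]

namespace CauchyPair.IsParallel

variable {P : CauchyPair S}

/-- Along times tending to `r` the Lipschitz bound makes the curve Cauchy, hence convergent to some
`p`. An integral curve with existence time `ε`, uniform near `p`, is glued on shortly before `r`. -/
theorem exists_extend_right [T2Space S] (hP : P.IsParallel) (hc : P.IsComplete) {a b : ℝ}
    (hab : a ^ 2 + b ^ 2 ≤ 1) {γ : ℝ → S} {l r : ℝ} (hlr : l < r)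
    (hγ : IsMIntegralCurveOn (I := 𝓡 3) γ (P.leafField a b) (Ioo l r)) :
    ∃ ε > 0, ∃ γ' : ℝ → S, EqOn γ' γ (Ioo l r) ∧
      IsMIntegralCurveOn (I := 𝓡 3) γ' (P.leafField a b) (Ioo l (r + ε)) := by
  -- The shift by 2 keeps `t 0` strictly to the right of `l`.
  set t : ℕ → ℝ := fun n => r - (r - l) / (n + 2) with ht
  have htmem : ∀ n, t n ∈ Ioo l r := fun n => by
    have h1 : (0 : ℝ) < n + 2 := by positivity
    have h2 : 0 < (r - l) / (n + 2) := div_pos (by linarith) h1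
    have h3 : (r - l) / (n + 2) < r - l := by
      rw [div_lt_iff₀ h1]
      nlinarith [(Nat.cast_nonneg n : (0 : ℝ) ≤ n)]
    constructor <;> simp only [ht] <;> linarith
  have htlim : Tendsto t atTop (𝓝 r) := by
    have h1 : Tendsto (fun n : ℕ => (n : ℝ) + 2) atTop atTop :=
      tendsto_atTop_add_const_right _ _ tendsto_natCast_atTop_atTop
    simpa using (tendsto_const_nhds (x := r)).sub ((tendsto_const_nhds (x := r - l)).div_atTop h1)
  have hcauchy : ∀ ε : ℝ≥0∞, 0 < ε → ∃ N, ∀ m ≥ N, ∀ n ≥ N,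
      P.rDist (γ (t m)) (γ (t n)) < ε := by
    intro ε hε
    obtain ⟨δ, hδ, hδε⟩ : ∃ δ : ℝ, 0 < δ ∧ ENNReal.ofReal δ < ε := by
      obtain ⟨q, hq, hqε⟩ := ENNReal.lt_iff_exists_nnreal_btwn.1 hε
      exact ⟨q, by exact_mod_cast hq, by simpa using hqε⟩
    obtain ⟨N, hN⟩ := eventually_atTop.1 (htlim.eventually (lt_mem_nhds (by linarith : r - δ < r)))
    refine ⟨N, fun m hm n hn => lt_of_le_of_lt ?_ hδε⟩
    have hm1 := hN m hm
    have hn1 := hN n hn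
    have hm2 := htmem m
    have hn2 := htmem n
    rcases le_total (t m) (t n) with h | h
    · exact (hP.rDist_integralCurve_le hab h isOpen_Ioo (Icc_subset_Ioo hm2.1 hn2.2) hγ).1.trans
        (ENNReal.ofReal_le_ofReal (by linarith [hn2.2]))
    · exact (hP.rDist_integralCurve_le hab h isOpen_Ioo (Icc_subset_Ioo hn2.1 hm2.2) hγ).2.trans
        (ENNReal.ofReal_le_ofReal (by linarith [hm2.2]))
  obtain ⟨p, hp⟩ := hc (fun n => γ (t n)) hcauchy
  obtain ⟨ε, hε, hev⟩ := hP.exists_uniform_time a b p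
  obtain ⟨n, ⟨η, hη0, hη⟩, hn⟩ :=
    ((hp.eventually hev).and (htlim.eventually (lt_mem_nhds (by linarith : r - ε / 2 < r)))).exists
  have hη' := hη.comp_add (-t n)
  have hη'' : IsMIntegralCurveOn (I := 𝓡 3) (η ∘ (· + -t n)) (P.leafField a b)
      (Ioo (t n - ε) (t n + ε)) := hη'.mono fun s hs => by
    simp only [mem_ofPred_eq, mem_Ioo] at hs ⊢
    constructor <;> linarith [hs.1, hs.2]
  classical
  have hpw := isMIntegralCurveOn_piecewise (P.contMDiff_leafField a b) hγ hη'' (t₀ := t n)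
    ⟨htmem n, by constructor <;> linarith⟩ (by simp [hη0])
  -- Since `t n > r - ε / 2`, the glued curve lives beyond `r + ε / 2`.
  refine ⟨ε / 2, by positivity, _, piecewise_eqOn _ _ _, hpw.mono fun s hs => ?_⟩
  rcases lt_or_ge s r with h | h
  · exact Or.inl ⟨hs.1, h⟩
  · exact Or.inr ⟨by linarith [(htmem n).2], by linarith [hs.2]⟩

theorem neg_one_smul_leafField (P : CauchyPair S) (a b : ℝ) :
    (-1 : ℝ) • P.leafField a b = P.leafField (-a) (-b) := by
  ext1 x
  simp [leafField]

theorem isMIntegralCurveOn_comp_neg {a b : ℝ} {γ : ℝ → S} {l r : ℝ}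
    (hγ : IsMIntegralCurveOn (I := 𝓡 3) γ (P.leafField a b) (Ioo l r)) :
    IsMIntegralCurveOn (I := 𝓡 3) (fun t => γ (-t)) (P.leafField (-a) (-b)) (Ioo (-r) (-l)) := by
  have h := hγ.comp_mul (-1)
  rw [neg_one_smul_leafField] at h
  have h2 : γ ∘ (· * (-1)) = fun t => γ (-t) := by
    ext t
    simp
  rw [h2] at h
  refine h.mono fun t ht => ?_
  simp only [mem_ofPred_eq, mem_Ioo] at ht ⊢
  constructor <;> linarith [ht.1, ht.2]

/-- The left end is handled by reversing time, which negates the field and preserves the bound on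
its length. -/
theorem exists_extend [T2Space S] (hP : P.IsParallel) (hc : P.IsComplete) {a b : ℝ}
    (hab : a ^ 2 + b ^ 2 ≤ 1) {γ : ℝ → S} {r : ℝ} (hr : 0 < r)
    (hγ : IsMIntegralCurveOn (I := 𝓡 3) γ (P.leafField a b) (Ioo (-r) r)) :
    ∃ R > r, ∃ γ' : ℝ → S, γ' 0 = γ 0 ∧
      IsMIntegralCurveOn (I := 𝓡 3) γ' (P.leafField a b) (Ioo (-R) R) := by
  obtain ⟨ε, hε, γ₁, h1, hγ₁⟩ := hP.exists_extend_right hc hab (by linarith) hγ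
  obtain ⟨δ, hδ, γ₂, h2, hγ₂⟩ := hP.exists_extend_right hc (by simpa using hab) (by linarith)
    (isMIntegralCurveOn_comp_neg hγ₁)
  have h3 := isMIntegralCurveOn_comp_neg hγ₂
  simp only [neg_neg] at h3
  refine ⟨r + min ε δ, by simp [hε, hδ], fun t => γ₂ (-t), ?_, h3.mono ?_⟩
  · have h4 := h2 (x := -0) (by constructor <;> linarith)
    simp only [neg_zero] at h4 ⊢
    rw [h4, h1 ⟨by linarith, hr⟩]
  · exact Ioo_subset_Ioo (by linarith [min_le_right ε δ]) (by linarith [min_le_left ε δ])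

/-- If the symmetric existence intervals were bounded, the solutions on smaller intervals would glue
to one on the supremal interval, which could still be extended. -/
theorem isComplete_leafField [T2Space S] (hP : P.IsParallel) (hc : P.IsComplete) {a b : ℝ}
    (hab : a ^ 2 + b ^ 2 ≤ 1) : IsCompleteVField (P.leafField a b) := by
  intro x
  rw [exists_isMIntegralCurve_iff_exists_isMIntegralCurveOn_Ioo (P.contMDiff_leafField a b)]
  by_contra! hno
  obtain ⟨T₀, hT₀⟩ := hno
  set A : Set ℝ := {T | ∃ γ : ℝ → S, γ 0 = x ∧
    IsMIntegralCurveOn (I := 𝓡 3) γ (P.leafField a b) (Ioo (-T) T)} with hA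
  have hdown : ∀ T ∈ A, ∀ T' ≤ T, T' ∈ A := fun T ⟨γ, h0, h1⟩ T' hT' =>
    ⟨γ, h0, h1.mono (Ioo_subset_Ioo (by linarith) hT')⟩
  have hbdd : BddAbove A := ⟨T₀, fun T hT => le_of_not_ge fun h => by
    obtain ⟨γ, h0, h1⟩ := hdown T hT T₀ h
    exact hT₀ γ h0 h1⟩
  obtain ⟨ε, hε, hev⟩ := hP.exists_uniform_time a b x
  have hεA : ε ∈ A := hev.self_of_nhds
  set r := sSup A with hr
  have hr0 : 0 < r := hε.trans_le (le_csSup hbdd hεA)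
  have hlt : ∀ T < r, T ∈ A := fun T hT => by
    obtain ⟨T', hT', h⟩ := exists_lt_of_lt_csSup ⟨ε, hεA⟩ hT
    exact hdown T' hT' T h.le
  have : Nonempty S := ⟨x⟩
  choose! γ hγ0 hγ using hlt
  -- Midway between `|t|` and `r`: the solution on `(-m t, m t)` is defined at `t`, and near `t` it
  -- agrees with the other choices.
  set m : ℝ → ℝ := fun t => (|t| + r) / 2 with hm
  have hagree : ∀ T < r, ∀ T' < r, ∀ t, |t| < T → |t| < T' → γ T t = γ T' t := by
    intro T hT T' hT' t h1 h2
    have hmin : |t| < min T T' := lt_min h1 h2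
    have h3 : 0 < min T T' := (abs_nonneg t).trans_lt hmin
    refine isMIntegralCurveOn_Ioo_eqOn_of_contMDiff_boundaryless (t₀ := 0) ⟨by linarith, h3⟩
      (P.contMDiff_leafField a b)
      ((hγ T hT).mono (Ioo_subset_Ioo (neg_le_neg (min_le_left T T')) (min_le_left T T')))
      ((hγ T' hT').mono (Ioo_subset_Ioo (neg_le_neg (min_le_right T T')) (min_le_right T T')))
      (by rw [hγ0 T hT, hγ0 T' hT']) (abs_lt.1 hmin)
  have hγr : IsMIntegralCurveOn (I := 𝓡 3) (fun t => γ (m t) t) (P.leafField a b) (Ioo (-r) r) := by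
    intro t ht
    have htr : |t| < r := abs_lt.2 ht
    have hmt : m t < r := by simp only [hm]; linarith
    have htm : |t| < m t := by simp only [hm]; linarith
    have h1 : HasMFDerivAt 𝓘(ℝ, ℝ) (𝓡 3) (γ (m t)) t _ :=
      ((hγ (m t) hmt).isMIntegralCurveAt (Ioo_mem_nhds (abs_lt.1 htm).1
        (abs_lt.1 htm).2)).hasMFDerivAt
    have h2 : (fun s => γ (m s) s) =ᶠ[𝓝 t] γ (m t) := by
      filter_upwards [Ioo_mem_nhds (abs_lt.1 htm).1 (abs_lt.1 htm).2] with s hs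
      have hs' : |s| < m t := abs_lt.2 hs
      exact hagree _ (by simp only [hm]; linarith) _ hmt s (by simp only [hm]; linarith) hs'
    have h3 : HasMFDerivAt 𝓘(ℝ, ℝ) (𝓡 3) (fun s => γ (m s) s) t
        ((1 : ℝ →L[ℝ] ℝ).smulRight (P.leafField a b (γ (m t) t))) := h1.congr_of_eventuallyEq h2
    exact h3.hasMFDerivWithinAt
  obtain ⟨R, hR, γ', h0, h1⟩ := hP.exists_extend hc hab hr0 hγr
  have hRA : R ∈ A := ⟨γ', by rw [h0]; exact hγ0 _ (by simp [hm, hr0]), h1⟩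
  exact absurd (le_csSup hbdd hRA) (not_le.2 hR)

end CauchyPair.IsParallel

end

/-! ### Commuting flows and the action of the plane -/

section

/-- Such a property is locally constant as a map to `Prop`. This is the continuation principle
behind the commuting flows, the smoothness of the action and the containment of integral surfaces in
orbits. -/
theorem forall_of_eventually_iff {X : Type*} [TopologicalSpace X] [PreconnectedSpace X]
    {p : X → Prop} (h : ∀ x, ∀ᶠ y in 𝓝 x, p y ↔ p x) {x₀ : X} (h₀ : p x₀) (x : X) : p x := by
  have hl : IsLocallyConstant p := (IsLocallyConstant.iff_eventually_eq p).2 fun x =>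
    (h x).mono fun y hy => propext hy
  rw [hl.apply_eq_of_preconnectedSpace x x₀]
  exact h₀

/-- Two flows that commute locally commute. -/
theorem flow_commute_of_local {X : Type*} {φ χ : ℝ → X → X}
    (hφ : ∀ s t p, φ (s + t) p = φ s (φ t p)) (hφ₀ : ∀ p, φ 0 p = p)
    (hχ : ∀ s t p, χ (s + t) p = χ s (χ t p)) (hχ₀ : ∀ p, χ 0 p = p)
    (hloc : ∀ q, ∃ ε > 0, ∀ s t, |s| < ε → |t| < ε → φ s (χ t q) = χ t (φ s q))
    (s t : ℝ) (q : X) : φ s (χ t q) = χ t (φ s q) := by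
  have hφi : ∀ r, Function.Injective (φ r) := fun r =>
    Function.LeftInverse.injective (g := φ (-r)) fun p => by rw [← hφ, neg_add_cancel, hφ₀]
  have hχi : ∀ r, Function.Injective (χ r) := fun r =>
    Function.LeftInverse.injective (g := χ (-r)) fun p => by rw [← hχ, neg_add_cancel, hχ₀]
  -- Continuation in `t` first, for germs in `s` at 0: the admissible range of `s` may shrink as `t`
  -- moves. Continuation in `s` follows.
  have hsmall : ∀ (q : X) (t : ℝ), ∀ᶠ s in 𝓝 (0 : ℝ), φ s (χ t q) = χ t (φ s q) := by
    intro q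
    refine forall_of_eventually_iff (x₀ := 0) (fun t₀ => ?_) (by simp [hχ₀])
    obtain ⟨ε, hε, h⟩ := hloc (χ t₀ q)
    filter_upwards [Metric.ball_mem_nhds t₀ hε] with t ht
    rw [Metric.mem_ball, Real.dist_eq] at ht
    refine eventually_congr ?_
    filter_upwards [Metric.ball_mem_nhds (0 : ℝ) hε] with s hs
    rw [Metric.mem_ball, Real.dist_eq, sub_zero] at hs
    have h1 := h s (t - t₀) hs ht
    rw [← hχ, sub_add_cancel] at h1
    have h2 : χ t (φ s q) = χ (t - t₀) (χ t₀ (φ s q)) := by rw [← hχ, sub_add_cancel]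
    rw [h1, h2, (hχi _).eq_iff]
  refine forall_of_eventually_iff (p := fun s => φ s (χ t q) = χ t (φ s q)) (x₀ := 0)
    (fun s₀ => ?_) (by simp [hφ₀]) s
  have h0 : Tendsto (fun s => s - s₀) (𝓝 s₀) (𝓝 0) := by
    have : Tendsto (fun s : ℝ => s - s₀) (𝓝 s₀) (𝓝 (s₀ - s₀)) := tendsto_id.sub_const s₀
    rwa [sub_self] at this
  filter_upwards [h0.eventually (hsmall (φ s₀ q) t)] with s hs
  have h1 : φ s q = φ (s - s₀) (φ s₀ q) := by rw [← hφ, sub_add_cancel]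
  have h2 : φ s (χ t q) = φ (s - s₀) (φ s₀ (χ t q)) := by rw [← hφ, sub_add_cancel]
  rw [h1, h2, ← hs, (hφi _).eq_iff]

theorem exists_Ioo_subset_of_isOpen_ordConnected {J : Set ℝ} (hJ : IsOpen J) (hc : J.OrdConnected)
    {s t : ℝ} (hs : s ∈ J) (ht : t ∈ J) :
    ∃ l r, s ∈ Ioo l r ∧ t ∈ Ioo l r ∧ Ioo l r ⊆ J := by
  wlog hst : s ≤ t generalizing s t
  · obtain ⟨l, r, h1, h2, h3⟩ := this ht hs (le_of_not_ge hst)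
    exact ⟨l, r, h2, h1, h3⟩
  obtain ⟨ε, hε, h1⟩ := Metric.isOpen_iff.1 hJ s hs
  obtain ⟨δ, hδ, h2⟩ := Metric.isOpen_iff.1 hJ t ht
  rw [Real.ball_eq_Ioo] at h1 h2
  refine ⟨s - ε, t + δ, ⟨by linarith, by linarith⟩, ⟨by linarith, by linarith⟩, fun x hx => ?_⟩
  rcases le_total x s with h | h
  · exact h1 ⟨hx.1, by linarith⟩
  rcases le_total x t with h' | h'
  · exact hc.out hs ht ⟨h, h'⟩
  · exact h2 ⟨by linarith, hx.2⟩

variable {S : Type*} [TopologicalSpace S] [ChartedSpace E3 S] [IsManifold (𝓡 3) ∞ S]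

namespace CauchyPair

variable {P : CauchyPair S}

/-- By convexity the times at which the straight line lies in `B` form an open interval. It contains
`0` and `τ`, and uniqueness of integral curves applies on it. -/
theorem IsStraightening.integralCurve_eq [T2Space S] {ψ : OpenPartialHomeomorph S (ℝ × ℝ × ℝ)}
    (h : P.IsStraightening ψ) {B : Set (ℝ × ℝ × ℝ)} (hB : Convex ℝ B) (hBo : IsOpen B)
    (hBt : B ⊆ ψ.target) {a b τ : ℝ} {c : ℝ × ℝ × ℝ} (hc : c ∈ B) (hcτ : c + τ • (0, a, b) ∈ B)
    {γ : ℝ → S} (hγ : IsMIntegralCurve (I := 𝓡 3) γ (P.leafField a b)) (hγ0 : γ 0 = ψ.symm c) :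
    γ τ = ψ.symm (c + τ • (0, a, b)) := by
  have hline : Continuous fun t : ℝ => c + t • ((0, a, b) : ℝ × ℝ × ℝ) := by fun_prop
  have hconv : Convex ℝ ((fun t : ℝ => c + t • ((0, a, b) : ℝ × ℝ × ℝ)) ⁻¹' B) := by
    intro s hs t ht x y hx hy hxy
    have h1 := hB hs ht hx hy hxy
    refine (congrArg (· ∈ B) ?_).mp h1
    simp only [smul_add, smul_eq_mul, add_smul, mul_smul]
    rw [add_add_add_comm, ← add_smul, hxy, one_smul]
  obtain ⟨l, r, h0, hτ, hsub⟩ := exists_Ioo_subset_of_isOpen_ordConnected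
    (hBo.preimage hline) hconv.ordConnected (s := 0) (t := τ)
    (by rwa [mem_preimage, zero_smul, add_zero]) hcτ
  exact isMIntegralCurveOn_Ioo_eqOn_of_contMDiff_boundaryless h0 (P.contMDiff_leafField a b)
    (hγ.isMIntegralCurveOn _) (h.isMIntegralCurveOn_line c a b fun t ht => hBt (hsub ht))
    (by simp [hγ0]) hτ

/-- A box of a straightening chart, in which an action generated by the leaf fields is by
translations. -/
structure IsActionBox (A : AddAction (ℝ × ℝ) S) (ψ : OpenPartialHomeomorph S (ℝ × ℝ × ℝ))
    (m : ℝ × ℝ × ℝ) (δ : ℝ) : Prop where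
  ball_subset : Metric.ball m δ ⊆ ψ.target
  vadd_eq : ∀ c ∈ Metric.ball m δ, ∀ v : ℝ × ℝ, c + (0, v) ∈ Metric.ball m δ →
    v +ᵥ ψ.symm c = ψ.symm (c + (0, v))

theorem mem_ball_box_iff {m c : ℝ × ℝ × ℝ} {δ : ℝ} : c ∈ Metric.ball m δ ↔
    |c.1 - m.1| < δ ∧ |c.2.1 - m.2.1| < δ ∧ |c.2.2 - m.2.2| < δ := by
  simp [Metric.mem_ball, Prod.dist_eq, Real.dist_eq]

/-- Balls for the product norm are boxes, so moving the two leaf coordinates one after the other, in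
either order, never leaves the ball. -/
theorem IsStraightening.flows_box [T2Space S] {ψ : OpenPartialHomeomorph S (ℝ × ℝ × ℝ)}
    (h : P.IsStraightening ψ) {m : ℝ × ℝ × ℝ} {δ : ℝ} (hB : Metric.ball m δ ⊆ ψ.target)
    {φ χ : ℝ → S → S}
    (hφ : ∀ p, IsMIntegralCurve (I := 𝓡 3) (fun t => φ t p) (P.sharp 1)) (hφ₀ : ∀ p, φ 0 p = p)
    (hχ : ∀ p, IsMIntegralCurve (I := 𝓡 3) (fun t => χ t p) (P.sharp 2)) (hχ₀ : ∀ p, χ 0 p = p)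
    {c : ℝ × ℝ × ℝ} (hc : c ∈ Metric.ball m δ) (v : ℝ × ℝ) (hv : c + (0, v) ∈ Metric.ball m δ) :
    φ v.1 (χ v.2 (ψ.symm c)) = ψ.symm (c + (0, v)) ∧
      χ v.2 (φ v.1 (ψ.symm c)) = ψ.symm (c + (0, v)) := by
  rw [← leafField_one_zero] at hφ
  rw [← leafField_zero_one] at hχ
  have hφ' : ∀ c ∈ Metric.ball m δ, ∀ s, c + s • ((0, 1, 0) : ℝ × ℝ × ℝ) ∈ Metric.ball m δ →
      φ s (ψ.symm c) = ψ.symm (c + s • ((0, 1, 0) : ℝ × ℝ × ℝ)) := fun c hc s hs =>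
    h.integralCurve_eq (convex_ball m δ) Metric.isOpen_ball hB hc hs (hφ _) (hφ₀ _)
  have hχ' : ∀ c ∈ Metric.ball m δ, ∀ s, c + s • ((0, 0, 1) : ℝ × ℝ × ℝ) ∈ Metric.ball m δ →
      χ s (ψ.symm c) = ψ.symm (c + s • ((0, 0, 1) : ℝ × ℝ × ℝ)) := fun c hc s hs =>
    h.integralCurve_eq (convex_ball m δ) Metric.isOpen_ball hB hc hs (hχ _) (hχ₀ _)
  have h1 : c + v.1 • ((0, 1, 0) : ℝ × ℝ × ℝ) ∈ Metric.ball m δ := by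
    rw [mem_ball_box_iff] at hc hv ⊢
    simp at hc hv ⊢
    exact ⟨hc.1, hv.2.1, hc.2.2⟩
  have h2 : c + v.2 • ((0, 0, 1) : ℝ × ℝ × ℝ) ∈ Metric.ball m δ := by
    rw [mem_ball_box_iff] at hc hv ⊢
    simp at hc hv ⊢
    exact ⟨hc.1, hc.2.1, hv.2.2⟩
  have e1 : c + v.1 • ((0, 1, 0) : ℝ × ℝ × ℝ) + v.2 • ((0, 0, 1) : ℝ × ℝ × ℝ) = c + (0, v) := by
    ext <;> simp
  have e2 : c + v.2 • ((0, 0, 1) : ℝ × ℝ × ℝ) + v.1 • ((0, 1, 0) : ℝ × ℝ × ℝ) = c + (0, v) := by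
    ext <;> simp
  constructor
  · rw [hχ' c hc _ h2, hφ' _ h2 _ (by rwa [e2]), e2]
  · rw [hφ' c hc _ h1, hχ' _ h1 _ (by rwa [e1]), e1]

theorem exists_flow [T2Space S] {X : VField S} (hX : IsSmoothVField X) (hc : IsCompleteVField X) :
    ∃ φ : ℝ → S → S, (∀ p, IsMIntegralCurve (I := 𝓡 3) (fun t => φ t p) X) ∧ (∀ p, φ 0 p = p) ∧
      ∀ s t p, φ (s + t) p = φ s (φ t p) := by
  choose c hc0 hc using hc
  refine ⟨fun t p => c p t, hc, hc0, fun s t p => ?_⟩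
  have h := isMIntegralCurve_Ioo_eq_of_contMDiff_boundaryless (t₀ := 0)
    (hX.of_le (by simp)) ((hc p).comp_add t) (hc (c p t)) (by simp [hc0])
  exact congrFun h s

/-- The action of `ℝ²` generated by the leaf frame. -/
theorem IsParallel.exists_addAction [T2Space S] (hP : P.IsParallel) (hc : P.IsComplete) :
    ∃ A : AddAction (ℝ × ℝ) S, IsGeneratedBy A (P.sharp 1) (P.sharp 2) := by
  obtain ⟨φ, hφ, hφ₀, hφa⟩ := exists_flow (P.isSmooth_sharp 1)
    (P.leafField_one_zero ▸ hP.isComplete_leafField hc (by norm_num))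
  obtain ⟨χ, hχ, hχ₀, hχa⟩ := exists_flow (P.isSmooth_sharp 2)
    (P.leafField_zero_one ▸ hP.isComplete_leafField hc (by norm_num))
  have hcomm : ∀ s t q, φ s (χ t q) = χ t (φ s q) := by
    refine flow_commute_of_local hφa hφ₀ hχa hχ₀ fun q => ?_
    obtain ⟨ψ, hq, hψ⟩ := hP.exists_isStraightening q
    obtain ⟨δ, hδ, hB⟩ := Metric.isOpen_iff.1 ψ.open_target _ (ψ.map_source hq)
    refine ⟨δ, hδ, fun s t hs ht => ?_⟩
    have h := hψ.flows_box hB hφ hφ₀ hχ hχ₀ (Metric.mem_ball_self hδ) (s, t) (by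
      rw [mem_ball_box_iff]
      simp [hs, ht, hδ])
    rw [ψ.left_inv hq] at h
    exact h.1.trans h.2.symm
  refine ⟨{ vadd := fun v p => φ v.1 (χ v.2 p)
            zero_vadd := fun p => by
              change φ 0 (χ 0 p) = p
              rw [hχ₀, hφ₀]
            add_vadd := fun v w p => by
              change φ (v.1 + w.1) (χ (v.2 + w.2) p) = φ v.1 (χ v.2 (φ w.1 (χ w.2 p)))
              rw [hφa, hχa, hcomm w.1] }, fun p => ⟨?_, ?_⟩⟩
  · change IsMIntegralCurve (I := 𝓡 3) (fun t => φ t (χ 0 p)) _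
    exact hφ _
  · change IsMIntegralCurve (I := 𝓡 3) (fun t => φ 0 (χ t p)) _
    simp only [hφ₀]
    exact hχ p

end CauchyPair

end

/-! ### Uniqueness, smoothness and local freeness of the action -/

section

variable {S : Type*} [TopologicalSpace S] [ChartedSpace E3 S] [IsManifold (𝓡 3) ∞ S]

namespace CauchyPair

variable {P : CauchyPair S}

theorem vadd_eq_vadd_vadd {X : Type*} [AddAction (ℝ × ℝ) X] (v : ℝ × ℝ) (p : X) :
    v +ᵥ p = ((v.1, 0) : ℝ × ℝ) +ᵥ (((0, v.2) : ℝ × ℝ) +ᵥ p) := by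
  rw [vadd_vadd]
  simp

/-- Integral curves are unique, so the two coordinate axes act in a prescribed way, and they
generate ℝ². -/
theorem addAction_unique [T2Space S] {A B : AddAction (ℝ × ℝ) S}
    (hA : IsGeneratedBy A (P.sharp 1) (P.sharp 2)) (hB : IsGeneratedBy B (P.sharp 1) (P.sharp 2)) :
    B = A := by
  have h1 : ∀ (t : ℝ) (p : S), B.vadd (t, 0) p = A.vadd (t, 0) p := fun t p =>
    congrFun (isMIntegralCurve_Ioo_eq_of_contMDiff_boundaryless (t₀ := 0)
      ((P.isSmooth_sharp 1).of_le (by simp)) (hB p).1 (hA p).1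
      ((B.zero_vadd p).trans (A.zero_vadd p).symm)) t
  have h2 : ∀ (t : ℝ) (p : S), B.vadd (0, t) p = A.vadd (0, t) p := fun t p =>
    congrFun (isMIntegralCurve_Ioo_eq_of_contMDiff_boundaryless (t₀ := 0)
      ((P.isSmooth_sharp 2).of_le (by simp)) (hB p).2 (hA p).2
      ((B.zero_vadd p).trans (A.zero_vadd p).symm)) t
  refine AddAction.ext (funext fun v => funext fun p => ?_)
  refine (@vadd_eq_vadd_vadd S B v p).trans (Eq.trans ?_ (@vadd_eq_vadd_vadd S A v p).symm)
  exact (h1 _ _).trans (congrArg (A.vadd (v.1, 0)) (h2 _ _))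

theorem IsParallel.exists_actionBox [T2Space S] (hP : P.IsParallel) {A : AddAction (ℝ × ℝ) S}
    (hA : IsGeneratedBy A (P.sharp 1) (P.sharp 2)) (p : S) :
    ∃ (ψ : OpenPartialHomeomorph S (ℝ × ℝ × ℝ)) (δ : ℝ), 0 < δ ∧ p ∈ ψ.source ∧
      P.IsStraightening ψ ∧ IsActionBox A ψ (ψ p) δ := by
  obtain ⟨ψ, hp, hψ⟩ := hP.exists_isStraightening p
  obtain ⟨δ, hδ, hB⟩ := Metric.isOpen_iff.1 ψ.open_target _ (ψ.map_source hp)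
  refine ⟨ψ, δ, hδ, hp, hψ, hB, fun c hc v hv => ?_⟩
  rw [vadd_eq_vadd_vadd]
  exact (hψ.flows_box hB (φ := fun t p => ((t, 0) : ℝ × ℝ) +ᵥ p)
    (χ := fun t p => ((0, t) : ℝ × ℝ) +ᵥ p) (fun p => (hA p).1) (fun p => A.zero_vadd p)
    (fun p => (hA p).2) (fun p => A.zero_vadd p) hc v hv).1

theorem zero_prod_mem_ball {m : ℝ × ℝ × ℝ} {δ : ℝ} {v : ℝ × ℝ} (hv : ‖v‖ < δ) :
    m + (0, v) ∈ Metric.ball m δ := by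
  simp [Prod.norm_def] at hv ⊢
  exact hv

section Action

variable [A : AddAction (ℝ × ℝ) S]

theorem IsActionBox.vadd_eq_self {ψ : OpenPartialHomeomorph S (ℝ × ℝ × ℝ)} {p : S} {δ : ℝ}
    (hδ : 0 < δ) (hp : p ∈ ψ.source) (h : IsActionBox A ψ (ψ p) δ) {v : ℝ × ℝ} (hv : ‖v‖ < δ) :
    v +ᵥ p = ψ.symm (ψ p + (0, v)) := by
  have h1 := h.vadd_eq (ψ p) (Metric.mem_ball_self hδ) v (zero_prod_mem_ball hv)
  rwa [ψ.left_inv hp] at h1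

theorem eventually_vadd_eq {ψ : OpenPartialHomeomorph S (ℝ × ℝ × ℝ)} {p : S} {δ : ℝ} (hδ : 0 < δ)
    (hp : p ∈ ψ.source) (h : IsActionBox A ψ (ψ p) δ) :
    ∀ᶠ z : (ℝ × ℝ) × S in 𝓝 (0, p), z.2 ∈ ψ.source ∧ ψ z.2 + (0, z.1) ∈ ψ.target ∧
      z.1 +ᵥ z.2 = ψ.symm (ψ z.2 + (0, z.1)) := by
  have hc1 : ContinuousAt (fun z : (ℝ × ℝ) × S => ψ z.2) (0, p) :=
    (ψ.continuousAt hp).comp (x := ((0, p) : (ℝ × ℝ) × S)) continuousAt_snd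
  have hc2 : ContinuousAt (fun z : (ℝ × ℝ) × S => ψ z.2 + ((0, z.1) : ℝ × ℝ × ℝ)) (0, p) :=
    hc1.add (by fun_prop)
  have h1 := hc1.eventually (Metric.ball_mem_nhds (ψ p) hδ)
  have h2 := hc2.eventually (Metric.ball_mem_nhds _ hδ)
  have h3 := continuousAt_snd (p := ((0, p) : (ℝ × ℝ) × S)).eventually
    (ψ.open_source.mem_nhds hp)
  have h4 : ψ p + (0, 0) = ψ p := add_zero _
  filter_upwards [h1, h2, h3] with z hz1 hz2 hz3
  simp only [h4] at hz2
  have h5 := h.vadd_eq _ hz1 z.1 hz2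
  rw [ψ.left_inv hz3] at h5
  exact ⟨hz3, h.ball_subset hz2, h5⟩

/-- The action map. -/
def actMap (S : Type*) [AddAction (ℝ × ℝ) S] (z : (ℝ × ℝ) × S) : S := z.1 +ᵥ z.2

variable [T2Space S]

theorem IsParallel.eventually_contMDiffAt_zero (hP : P.IsParallel)
    (hA : IsGeneratedBy A (P.sharp 1) (P.sharp 2)) (p : S) :
    ∀ᶠ z : (ℝ × ℝ) × S in 𝓝 (0, p),
      ContMDiffAt (𝓘(ℝ, ℝ × ℝ).prod (𝓡 3)) (𝓡 3) ∞ (actMap S) z := by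
  obtain ⟨ψ, δ, hδ, hp, hψ, hb⟩ := hP.exists_actionBox hA p
  filter_upwards [(eventually_vadd_eq hδ hp hb).eventually_nhds] with z hz
  obtain ⟨h1, h2, -⟩ := hz.self_of_nhds
  have h3 : ContMDiffAt (𝓘(ℝ, ℝ × ℝ).prod (𝓡 3)) 𝓘(ℝ, ℝ × ℝ × ℝ) ∞
      (fun z : (ℝ × ℝ) × S => ψ z.2 + ((0, z.1) : ℝ × ℝ × ℝ)) z := by
    have h4 : ContMDiffAt (𝓘(ℝ, ℝ × ℝ).prod (𝓡 3)) 𝓘(ℝ, ℝ × ℝ × ℝ) ∞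
        (fun z : (ℝ × ℝ) × S => ψ z.2) z := (hψ.contMDiffAt _ h1).comp z contMDiffAt_snd
    have h5 : ContMDiffAt (𝓘(ℝ, ℝ × ℝ).prod (𝓡 3)) 𝓘(ℝ, ℝ × ℝ × ℝ) ∞
        (fun z : (ℝ × ℝ) × S => ((0, z.1) : ℝ × ℝ × ℝ)) z := by
      have h6 : ContMDiff 𝓘(ℝ, ℝ × ℝ) 𝓘(ℝ, ℝ × ℝ × ℝ) ∞
        (fun v : ℝ × ℝ => ((0, v) : ℝ × ℝ × ℝ)) := ContDiff.contMDiff (by fun_prop)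
      exact h6.contMDiffAt.comp z contMDiffAt_fst
    exact h4.add h5
  exact ((hψ.contMDiffAt_symm _ h2).comp z h3).congr_of_eventuallyEq (hz.mono fun w hw => hw.2.2)

theorem eventually_contMDiffAt_add {v w : ℝ × ℝ} {p : S}
    (h1 : ∀ᶠ z in 𝓝 (v, p), ContMDiffAt (𝓘(ℝ, ℝ × ℝ).prod (𝓡 3)) (𝓡 3) ∞ (actMap S) z)
    (h2 : ∀ᶠ z in 𝓝 (w, v +ᵥ p), ContMDiffAt (𝓘(ℝ, ℝ × ℝ).prod (𝓡 3)) (𝓡 3) ∞ (actMap S) z) :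
    ∀ᶠ z in 𝓝 (w + v, p), ContMDiffAt (𝓘(ℝ, ℝ × ℝ).prod (𝓡 3)) (𝓡 3) ∞ (actMap S) z := by
  set ι : (ℝ × ℝ) × S → (ℝ × ℝ) × S := fun z => (v, z.2) with hι
  -- The action map factors through `κ`, because u · x = (u - v) · (v · x).
  set κ : (ℝ × ℝ) × S → (ℝ × ℝ) × S := fun z => (z.1 - v, actMap S (v, z.2)) with hκ
  have hιs : ContMDiff (𝓘(ℝ, ℝ × ℝ).prod (𝓡 3)) (𝓘(ℝ, ℝ × ℝ).prod (𝓡 3)) ∞ ι :=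
    contMDiff_const.prodMk contMDiff_snd
  have h3 : ∀ᶠ z in 𝓝 (w + v, p), ContMDiffAt (𝓘(ℝ, ℝ × ℝ).prod (𝓡 3)) (𝓘(ℝ, ℝ × ℝ).prod (𝓡 3))
      ∞ κ z := by
    have h4 : Tendsto ι (𝓝 (w + v, p)) (𝓝 (v, p)) := hιs.continuous.continuousAt
    filter_upwards [h4.eventually h1] with z hz
    have h5 : ContMDiffAt (𝓘(ℝ, ℝ × ℝ).prod (𝓡 3)) 𝓘(ℝ, ℝ × ℝ) ∞
        (fun z : (ℝ × ℝ) × S => z.1 - v) z := by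
      have h6 : ContMDiff 𝓘(ℝ, ℝ × ℝ) 𝓘(ℝ, ℝ × ℝ) ∞ (fun u : ℝ × ℝ => u - v) :=
        ContDiff.contMDiff (by fun_prop)
      exact h6.contMDiffAt.comp z contMDiffAt_fst
    exact h5.prodMk (hz.comp z hιs.contMDiffAt)
  have h4 : Tendsto κ (𝓝 (w + v, p)) (𝓝 (w, v +ᵥ p)) := by
    have := h3.self_of_nhds.continuousAt.tendsto
    simpa [hκ, actMap] using this
  filter_upwards [h3, h4.eventually h2] with z hz1 hz2
  refine (hz2.comp z hz1).congr_of_eventuallyEq (Eventually.of_forall fun z => ?_)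
  simp [actMap, hκ, vadd_vadd]

theorem IsParallel.isSmoothAction (hP : P.IsParallel)
    (hA : IsGeneratedBy A (P.sharp 1) (P.sharp 2)) : IsSmoothAction A := by
  suffices h : ∀ (p : S) (v : ℝ × ℝ), ∀ᶠ z in 𝓝 (v, p),
      ContMDiffAt (𝓘(ℝ, ℝ × ℝ).prod (𝓡 3)) (𝓡 3) ∞ (actMap S) z from
    ⟨fun z => (h z.2 z.1).self_of_nhds⟩
  intro p
  refine forall_of_eventually_iff (x₀ := 0) (fun v₀ => ?_) (hP.eventually_contMDiffAt_zero hA p)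
  have h0 := hP.eventually_contMDiffAt_zero hA (v₀ +ᵥ p)
  have hsub : Tendsto (fun v : ℝ × ℝ => v - v₀) (𝓝 v₀) (𝓝 0) := by
    have : Continuous fun v : ℝ × ℝ => v - v₀ := by fun_prop
    simpa using this.tendsto v₀
  have hsub' : Tendsto (fun v : ℝ × ℝ => v₀ - v) (𝓝 v₀) (𝓝 0) := by
    have : Continuous fun v : ℝ × ℝ => v₀ - v := by fun_prop
    simpa using this.tendsto v₀
  have h1 : Tendsto (fun v : ℝ × ℝ => (v - v₀, v₀ +ᵥ p)) (𝓝 v₀) (𝓝 (0, v₀ +ᵥ p)) :=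
    hsub.prodMk_nhds tendsto_const_nhds
  -- Continuity of the orbit map at `v₀` comes from v · p = (v - v₀) · (v₀ · p). It puts `v +ᵥ p`
  -- into the neighbourhood of `v₀ +ᵥ p` where small vectors act smoothly, so one can step from `v`
  -- back to `v₀`.
  have h2 : Tendsto (fun v : ℝ × ℝ => v +ᵥ p) (𝓝 v₀) (𝓝 (v₀ +ᵥ p)) := by
    have h3 := h0.self_of_nhds.continuousAt.tendsto.comp h1
    refine Tendsto.congr (fun v => ?_) (by simpa [actMap] using h3)
    simp [actMap, vadd_vadd]
  filter_upwards [h1.eventually h0.eventually_nhds,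
    (hsub'.prodMk_nhds h2).eventually h0.eventually_nhds] with v hv1 hv2
  constructor
  · intro h
    have := eventually_contMDiffAt_add h hv2
    rwa [sub_add_cancel] at this
  · intro h
    have := eventually_contMDiffAt_add h hv1
    rwa [sub_add_cancel] at this

theorem IsParallel.vadd_injOn (hP : P.IsParallel)
    (hA : IsGeneratedBy A (P.sharp 1) (P.sharp 2)) (p : S) :
    ∃ δ > 0, InjOn (fun v : ℝ × ℝ => v +ᵥ p) (Metric.ball 0 δ) := by
  obtain ⟨ψ, δ, hδ, hp, hψ, hb⟩ := hP.exists_actionBox hA p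
  refine ⟨δ, hδ, fun v hv w hw h => ?_⟩
  rw [mem_ball_zero_iff] at hv hw
  simp only [hb.vadd_eq_self hδ hp hv, hb.vadd_eq_self hδ hp hw] at h
  have h1 := ψ.symm.injOn (hb.ball_subset (zero_prod_mem_ball hv))
    (hb.ball_subset (zero_prod_mem_ball hw)) h
  simpa using h1

theorem IsParallel.isLocallyFreeAction (hP : P.IsParallel)
    (hA : IsGeneratedBy A (P.sharp 1) (P.sharp 2)) : IsLocallyFreeAction A := by
  intro p
  obtain ⟨δ, hδ, hinj⟩ := hP.vadd_injOn hA p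
  refine discreteTopology_of_isOpen_singleton_zero ?_
  rw [isOpen_induced_iff]
  refine ⟨Metric.ball 0 δ, Metric.isOpen_ball, ?_⟩
  ext v
  simp only [mem_preimage, mem_singleton_iff]
  constructor
  · intro hv
    refine Subtype.ext (hinj hv (Metric.mem_ball_self hδ) ?_)
    have h1 : (v : ℝ × ℝ) +ᵥ p = p := v.2
    simp only [h1]
    exact (zero_vadd _ p).symm
  · rintro rfl
    exact Metric.mem_ball_self hδ

/-- Near `v` the orbit map is w ↦ (w - v) · (v · p), a translation in a straightening chart at `v +ᵥ
p`. -/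
theorem IsParallel.hasMFDerivAt_vadd (hP : P.IsParallel)
    (hA : IsGeneratedBy A (P.sharp 1) (P.sharp 2)) (p : S) (v : ℝ × ℝ) :
    ∃ L : ℝ × ℝ →L[ℝ] TangentSpace (𝓡 3) (v +ᵥ p),
      HasMFDerivAt 𝓘(ℝ, ℝ × ℝ) (𝓡 3) (fun v : ℝ × ℝ => v +ᵥ p) v L ∧
      ∀ w, L w = P.leafField w.1 w.2 (v +ᵥ p) := by
  obtain ⟨ψ, δ, hδ, hp, hψ, hb⟩ := hP.exists_actionBox hA (v +ᵥ p)
  have h1 : (fun w : ℝ × ℝ => w +ᵥ p) =ᶠ[𝓝 v] fun w => ψ.symm (ψ (v +ᵥ p) + (0, w - v)) := by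
    filter_upwards [Metric.ball_mem_nhds v hδ] with w hw
    rw [mem_ball_iff_norm] at hw
    rw [← hb.vadd_eq_self hδ hp hw, vadd_vadd, sub_add_cancel]
  have h2 : HasFDerivAt (fun w : ℝ × ℝ => ψ (v +ᵥ p) + ((0, w - v) : ℝ × ℝ × ℝ))
      (ContinuousLinearMap.inr ℝ ℝ (ℝ × ℝ)) v := by
    have h3 := ((ContinuousLinearMap.inr ℝ ℝ (ℝ × ℝ)).hasFDerivAt.comp v
      ((hasFDerivAt_id v).sub_const v)).const_add (ψ (v +ᵥ p))
    exact h3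
  have h3 : ψ (v +ᵥ p) + ((0, v - v) : ℝ × ℝ × ℝ) = ψ (v +ᵥ p) := by
    rw [sub_self]
    exact add_zero _
  have h4 : HasMFDerivAt 𝓘(ℝ, ℝ × ℝ × ℝ) (𝓡 3) ψ.symm (ψ (v +ᵥ p) + ((0, v - v) : ℝ × ℝ × ℝ))
      (mfderiv 𝓘(ℝ, ℝ × ℝ × ℝ) (𝓡 3) ψ.symm (ψ (v +ᵥ p))) := by
    rw [h3]
    exact (hψ.mDifferentiable.mdifferentiableAt_symm (ψ.map_source hp)).hasMFDerivAt
  exact ⟨_, (h4.comp v h2.hasMFDerivAt).congr_of_eventuallyEq h1, fun w =>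
    hψ.mfderiv_symm_apply hp w.1 w.2⟩

end Action

end CauchyPair

end

/-! ### Manifold structure on translation quotients of a vector space -/

section

/-- A surjective open continuous map `q : E → N` on a vector space which is injective near `0`
and whose fibres are preserved by translations. -/
structure IsTranslationQuotient {E N : Type*} [NormedAddCommGroup E] [TopologicalSpace N]
    (q : E → N) : Prop where
  isOpenQuotientMap : IsOpenQuotientMap q
  add_right : ∀ v w u, q v = q w → q (v + u) = q (w + u)
  exists_injOn : ∃ δ > 0, InjOn q (Metric.ball 0 δ)

namespace IsTranslationQuotient

section

variable {E N : Type*} [NormedAddCommGroup E] [TopologicalSpace N] {q : E → N}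

/-- The radius of the balls on which the quotient map is injective. -/
noncomputable def radius (hq : IsTranslationQuotient q) : ℝ := hq.exists_injOn.choose

theorem radius_pos (hq : IsTranslationQuotient q) : 0 < hq.radius := hq.exists_injOn.choose_spec.1

theorem injOn_ball (hq : IsTranslationQuotient q) (v : E) : InjOn q (Metric.ball v hq.radius) := by
  intro w hw w' hw' h
  rw [mem_ball_iff_norm] at hw hw'
  have h1 := hq.add_right w w' (-v) h
  rw [← sub_eq_add_neg, ← sub_eq_add_neg] at h1
  exact sub_left_injective (hq.exists_injOn.choose_spec.2 (mem_ball_zero_iff.2 hw)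
    (mem_ball_zero_iff.2 hw') h1)

/-- A preimage of a point of the quotient. -/
noncomputable def lift (hq : IsTranslationQuotient q) (x : N) : E :=
  Function.surjInv hq.isOpenQuotientMap.surjective x

theorem apply_lift (hq : IsTranslationQuotient q) (x : N) : q (hq.lift x) = x :=
  Function.surjInv_eq _ x

/-- The quotient map restricted to a small ball. -/
noncomputable def param (hq : IsTranslationQuotient q) (x : N) : OpenPartialHomeomorph E N :=
  OpenPartialHomeomorph.ofContinuousOpen (hq.injOn_ball (hq.lift x)).toPartialEquiv
    hq.isOpenQuotientMap.continuous.continuousOn hq.isOpenQuotientMap.isOpenMap Metric.isOpen_ball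

theorem coe_param (hq : IsTranslationQuotient q) (x : N) : ⇑(hq.param x) = q := rfl

theorem lift_mem (hq : IsTranslationQuotient q) (x : N) : hq.lift x ∈ (hq.param x).source :=
  Metric.mem_ball_self hq.radius_pos

theorem mem_param_target (hq : IsTranslationQuotient q) (x : N) : x ∈ (hq.param x).target := by
  have h := (hq.param x).map_source (hq.lift_mem x)
  rwa [coe_param, hq.apply_lift] at h

/-- The charts of the quotient are the local inverses of the quotient map. -/
noncomputable abbrev chartedSpace (hq : IsTranslationQuotient q) : ChartedSpace E N where
  atlas := range fun x => (hq.param x).symm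
  chartAt x := (hq.param x).symm
  mem_chart_source x := hq.mem_param_target x
  chart_mem_atlas x := mem_range_self x

/-- Fibres are translation invariant, so q(w + (u - v)) = q(u). Hence the transition maps between
charts are local translations. -/
theorem eventually_param_symm_eq (hq : IsTranslationQuotient q) {x : N} {v w : E}
    (hw : w ∈ (hq.param x).source) (h : q w = q v) :
    ∀ᶠ u in 𝓝 v, (hq.param x).symm (q u) = w + (u - v) := by
  have h1 : Tendsto (fun u => w + (u - v)) (𝓝 v) (𝓝 w) := by
    have : Continuous fun u => w + (u - v) := by fun_prop
    simpa using this.tendsto v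
  filter_upwards [h1.eventually ((hq.param x).open_source.mem_nhds hw)] with u hu
  have h2 := hq.add_right w v (u - v) h
  rw [add_sub_cancel] at h2
  rw [← h2]
  exact (hq.param x).left_inv hu

theorem secondCountableTopology [SecondCountableTopology E] (hq : IsTranslationQuotient q) :
    SecondCountableTopology N :=
  hq.isOpenQuotientMap.isQuotientMap.secondCountableTopology hq.isOpenQuotientMap.isOpenMap

end

variable {E N : Type*} [NormedAddCommGroup E] [NormedSpace ℝ E] [TopologicalSpace N] {q : E → N}

theorem connectedSpace (hq : IsTranslationQuotient q) : ConnectedSpace N :=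
  hq.isOpenQuotientMap.surjective.connectedSpace hq.isOpenQuotientMap.continuous

theorem isManifold (hq : IsTranslationQuotient q) :
    letI := hq.chartedSpace
    IsManifold 𝓘(ℝ, E) ∞ N := by
  let := hq.chartedSpace
  refine isManifold_of_contDiffOn _ _ _ ?_
  rintro _ _ ⟨x, rfl⟩ ⟨y, rfl⟩ v hv
  simp only [modelWithCornersSelf_coe, modelWithCornersSelf_coe_symm, range_id, inter_univ,
    preimage_id_eq, id_eq, OpenPartialHomeomorph.trans_source, OpenPartialHomeomorph.symm_symm,
    OpenPartialHomeomorph.symm_source, mem_inter_iff, mem_preimage, coe_param] at hv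
  have h1 := (hq.param y).map_target hv.2
  have h2 := hq.eventually_param_symm_eq h1 ((hq.param y).right_inv hv.2)
  have h3 : ContDiffAt ℝ ∞ (fun u => (hq.param y).symm (q u)) v :=
    ContDiffAt.congr_of_eventuallyEq (by fun_prop) h2
  exact h3.contDiffWithinAt

variable {E' H' M : Type*} [NormedAddCommGroup E'] [NormedSpace ℝ E'] [TopologicalSpace H']
  {I : ModelWithCorners ℝ E' H'} [TopologicalSpace M] [ChartedSpace H' M]

theorem eventuallyEq_comp_chartAt (hq : IsTranslationQuotient q) (f : N → M) (x : N) :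
    letI := hq.chartedSpace
    f =ᶠ[𝓝 x] (fun v => f (q v)) ∘ chartAt E x := by
  let := hq.chartedSpace
  filter_upwards [(chartAt E x).open_source.mem_nhds (mem_chart_source E x)] with y hy
  exact congrArg f ((hq.param x).right_inv hy).symm

theorem contMDiff (hq : IsTranslationQuotient q) {f : N → M}
    (hf : ContMDiff 𝓘(ℝ, E) I ∞ fun v => f (q v)) :
    letI := hq.chartedSpace
    ContMDiff 𝓘(ℝ, E) I ∞ f := by
  let := hq.chartedSpace
  have := hq.isManifold
  intro x
  exact (hf.contMDiffAt.comp x ((contMDiffOn_chart (x := x)).contMDiffAt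
    ((chartAt E x).open_source.mem_nhds (mem_chart_source E x)))).congr_of_eventuallyEq
    (hq.eventuallyEq_comp_chartAt f x)

/-- `D` is the derivative of the chart at `x`. Its bijectivity is all that is needed to carry
injectivity and range from the plane to the quotient. -/
theorem exists_mfderiv_eq (hq : IsTranslationQuotient q) (f : N → M) (x : N) :
    letI := hq.chartedSpace
    ∃ v, q v = x ∧ ∀ L : E →L[ℝ] TangentSpace I (f (q v)),
      HasMFDerivAt 𝓘(ℝ, E) I (fun v => f (q v)) v L →
      ∃ D : E → E, Function.Bijective D ∧ ∀ w, mfderiv 𝓘(ℝ, E) I f x w = L (D w) := by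
  let := hq.chartedSpace
  have := hq.isManifold
  have : IsManifold 𝓘(ℝ, E) 1 N := IsManifold.of_le (n := ∞) (by simp)
  refine ⟨chartAt E x x, (hq.param x).right_inv (hq.mem_param_target x), fun L hL => ?_⟩
  have hc := mdifferentiable_chart (I := 𝓘(ℝ, E)) x
  have h1 := (hL.comp x (hc.mdifferentiableAt (mem_chart_source E x)).hasMFDerivAt).congr_of_eventuallyEq
    (hq.eventuallyEq_comp_chartAt f x)
  refine ⟨_, hc.mfderiv_bijective (mem_chart_source E x), fun w => ?_⟩
  exact congrArg (fun F : E →L[ℝ] E' => F w) h1.mfderiv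

end IsTranslationQuotient

end

/-! ### Orbits as integral surfaces -/

section

universe u

/-- A linear identification of the model of surfaces with `ℝ × ℝ`. -/
noncomputable def planeEquiv : E2 ≃L[ℝ] ℝ × ℝ := ContinuousLinearEquiv.ofFinrankEq (by simp)

/-- The orbit of a point, to be topologized as a quotient of the plane. -/
def OrbitSpace {S : Type u} [AddAction (ℝ × ℝ) S] (p : S) : Type u := AddAction.orbit (ℝ × ℝ) p

namespace OrbitSpace

section

variable {S : Type u} [AddAction (ℝ × ℝ) S]

/-- The inclusion of an orbit. -/
def incl (p : S) : OrbitSpace p → S := Subtype.val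

theorem incl_injective (p : S) : Function.Injective (incl p) := Subtype.val_injective

theorem range_incl (p : S) : range (incl p) = AddAction.orbit (ℝ × ℝ) p := Subtype.range_val

/-- The orbit map from the model plane. -/
noncomputable def orbitMap (p : S) (v : E2) : OrbitSpace p := ⟨planeEquiv v +ᵥ p, mem_range_self _⟩

theorem incl_orbitMap (p : S) (v : E2) : incl p (orbitMap p v) = planeEquiv v +ᵥ p := rfl

/-- An orbit may accumulate on itself in `S`, so the subspace topology would be too coarse for a
surface. -/
noncomputable instance (p : S) : TopologicalSpace (OrbitSpace p) :=
  TopologicalSpace.coinduced (orbitMap p) inferInstance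

theorem orbitMap_add_right (p : S) (v w u : E2) (h : orbitMap p v = orbitMap p w) :
    orbitMap p (v + u) = orbitMap p (w + u) := by
  refine incl_injective p ?_
  have h1 := congrArg (incl p) h
  rw [incl_orbitMap, incl_orbitMap] at h1
  rw [incl_orbitMap, incl_orbitMap, add_comm v, add_comm w, map_add, map_add, add_vadd, add_vadd, h1]

theorem orbitMap_surjective (p : S) : Function.Surjective (orbitMap p) := by
  rintro ⟨_, v, rfl⟩
  exact ⟨planeEquiv.symm v, incl_injective p (by
    rw [incl_orbitMap, planeEquiv.apply_symm_apply]
    rfl)⟩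

/-- The saturation of an open set is a union of its translates. -/
theorem isOpenMap_orbitMap (p : S) : IsOpenMap (orbitMap p) := by
  intro U hU
  refine isOpen_coinduced.2 (isOpen_iff_mem_nhds.2 ?_)
  rintro v ⟨w, hw, h⟩
  have h1 : Tendsto (fun u => w + (u - v)) (𝓝 v) (𝓝 w) := by
    have : Continuous fun u => w + (u - v) := by fun_prop
    simpa using this.tendsto v
  filter_upwards [h1.eventually (hU.mem_nhds hw)] with u hu
  refine ⟨_, hu, ?_⟩
  rw [orbitMap_add_right p w v (u - v) h, add_sub_cancel]

theorem isOpenQuotientMap_orbitMap (p : S) : IsOpenQuotientMap (orbitMap p) :=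
  ⟨orbitMap_surjective p, continuous_coinduced_rng, isOpenMap_orbitMap p⟩

end

end OrbitSpace

namespace CauchyPair

variable {S : Type u} [TopologicalSpace S] [ChartedSpace E3 S] [IsManifold (𝓡 3) ∞ S]
  {P : CauchyPair S}

theorem leafField_mem_ker (P : CauchyPair S) (a b : ℝ) (x : S) : P.e 0 x (P.leafField a b x) = 0 := by
  simp [leafField, e_sharp]

theorem leafField_injective (P : CauchyPair S) (x : S) :
    Function.Injective fun w : ℝ × ℝ => P.leafField w.1 w.2 x := by
  intro v w h
  have h1 := congrArg (P.e 1 x) h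
  have h2 := congrArg (P.e 2 x) h
  simp [leafField, e_sharp] at h1 h2
  exact Prod.ext h1 h2

theorem range_leafField (P : CauchyPair S) (x : S) :
    range (fun w : ℝ × ℝ => P.leafField w.1 w.2 x) = {v | P.e 0 x v = 0} := by
  ext v
  rw [mem_ofPred_eq, mem_range]
  constructor
  · rintro ⟨w, rfl⟩
    exact P.leafField_mem_ker _ _ _
  · intro h
    refine ⟨(P.e 1 x v, P.e 2 x v), ?_⟩
    conv_rhs => rw [P.eq_sum_sharp x v]
    simp [Fin.sum_univ_three, h, leafField]

variable [A : AddAction (ℝ × ℝ) S] [T2Space S]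

theorem IsParallel.isTranslationQuotient_orbitMap (hP : P.IsParallel)
    (hA : IsGeneratedBy A (P.sharp 1) (P.sharp 2)) (p : S) :
    IsTranslationQuotient (OrbitSpace.orbitMap p) := by
  refine ⟨OrbitSpace.isOpenQuotientMap_orbitMap p, OrbitSpace.orbitMap_add_right p, ?_⟩
  obtain ⟨δ, hδ, hinj⟩ := hP.vadd_injOn hA p
  have h1 : Tendsto planeEquiv (𝓝 0) (𝓝 0) := by simpa using planeEquiv.continuous.tendsto 0
  obtain ⟨ε, hε, h⟩ := Metric.mem_nhds_iff.1 (h1 (Metric.ball_mem_nhds 0 hδ))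
  exact ⟨ε, hε, fun v hv w hw hvw => planeEquiv.injective
    (hinj (h hv) (h hw) (congrArg (OrbitSpace.incl p) hvw))⟩

/-- Up to a bijective linear change of parameters, the derivative of the inclusion is (a, b) ↦ a
e_l^♯ + b e_n^♯, which is injective with range ker e_u. The Hausdorff property is inherited through
the continuous injection into `S`. -/
theorem IsParallel.isIntegralSurface_orbit (hP : P.IsParallel)
    (hA : IsGeneratedBy A (P.sharp 1) (P.sharp 2)) (p : S) :
    IsIntegralSurface (P.e 0) (AddAction.orbit (ℝ × ℝ) p) := by
  have hq := hP.isTranslationQuotient_orbitMap hA p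
  let := hq.chartedSpace
  have hs : ContMDiff (𝓡 2) (𝓡 3) ∞ fun v => OrbitSpace.incl p (OrbitSpace.orbitMap p v) :=
    (hP.isSmoothAction hA).contMDiff_vadd.comp
      (planeEquiv.contDiff.contMDiff.prodMk contMDiff_const)
  have hf : ContMDiff (𝓡 2) (𝓡 3) ∞ (OrbitSpace.incl p) := hq.contMDiff hs
  have hd : ∀ x : OrbitSpace p, ∃ D : E2 → ℝ × ℝ, Function.Bijective D ∧
      ⇑(mfderiv (𝓡 2) (𝓡 3) (OrbitSpace.incl p) x) =
        (fun w : ℝ × ℝ => P.leafField w.1 w.2 (OrbitSpace.incl p x)) ∘ D := by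
    intro x
    obtain ⟨v, rfl, h⟩ := hq.exists_mfderiv_eq (I := 𝓡 3) (OrbitSpace.incl p) x
    obtain ⟨L, hL, hL'⟩ := hP.hasMFDerivAt_vadd hA p (planeEquiv v)
    obtain ⟨D, hD, hD'⟩ := h _ (hL.comp v planeEquiv.hasFDerivAt.hasMFDerivAt)
    exact ⟨planeEquiv ∘ D, planeEquiv.bijective.comp hD, funext fun w => (hD' w).trans (hL' _)⟩
  refine ⟨OrbitSpace p, inferInstance, hq.chartedSpace, OrbitSpace.incl p, hq.isManifold,
    T2Space.of_injective_continuous (OrbitSpace.incl_injective p) hf.continuous,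
    hq.secondCountableTopology, hq.connectedSpace, hf, OrbitSpace.incl_injective p,
    fun x => ?_, fun x => ?_, OrbitSpace.range_incl p⟩
  · obtain ⟨D, hD, h⟩ := hd x
    rw [h]
    exact (P.leafField_injective _).comp hD.injective
  · obtain ⟨D, hD, h⟩ := hd x
    rw [h]
    exact (hD.surjective.range_comp _).trans (P.range_leafField _)

end CauchyPair

end

/-! ### Maximality of the orbits -/

section

universe u

namespace CauchyPair

variable {S : Type u} [TopologicalSpace S] [ChartedSpace E3 S] [IsManifold (𝓡 3) ∞ S]
  {P : CauchyPair S}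

/-- The derivative of `ψ` maps ker e_u into vectors with vanishing first component, so the first
coordinate of `ψ ∘ f` has zero derivative. -/
theorem IsStraightening.eventually_fst_eq {ψ : OpenPartialHomeomorph S (ℝ × ℝ × ℝ)}
    (hψ : P.IsStraightening ψ) {N : Type*} [TopologicalSpace N] [ChartedSpace E2 N]
    [IsManifold (𝓡 2) ∞ N] {f : N → S} (hf : ContMDiff (𝓡 2) (𝓡 3) ∞ f)
    (hk : ∀ y v, P.e 0 (f y) (mfderiv (𝓡 2) (𝓡 3) f y v) = 0) {y : N} (hy : f y ∈ ψ.source) :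
    ∀ᶠ z in 𝓝 y, (ψ (f z)).1 = (ψ (f y)).1 := by
  have : IsManifold (𝓡 2) 1 N := IsManifold.of_le (n := ∞) (by simp)
  set c := chartAt E2 y with hc
  have hyc : y ∈ c.source := mem_chart_source E2 y
  have hcd := mdifferentiable_chart (I := 𝓡 2) y
  have h1 : ∀ᶠ u in 𝓝 (c y), u ∈ c.target ∧ f (c.symm u) ∈ ψ.source := by
    have h2 : Tendsto (fun u => f (c.symm u)) (𝓝 (c y)) (𝓝 (f y)) := by
      have := (hf.continuous.tendsto _).comp (c.continuousAt_symm (c.map_source hyc))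
      rwa [c.left_inv hyc] at this
    exact (c.open_target.eventually_mem (c.map_source hyc)).and
      (h2.eventually (ψ.open_source.mem_nhds hy))
  obtain ⟨ε, hε, hB⟩ := Metric.mem_nhds_iff.1 h1
  have h2 : ∀ u ∈ Metric.ball (c y) ε, HasFDerivAt (fun u => (ψ (f (c.symm u))).1)
      (0 : E2 →L[ℝ] ℝ) u := by
    intro u hu
    obtain ⟨hu1, hu2⟩ := hB hu
    have h3 := (hψ.mDifferentiable.mdifferentiableAt hu2).hasMFDerivAt.comp u
      (((hf.mdifferentiable (by simp)) _).hasMFDerivAt.comp u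
        (hcd.mdifferentiableAt_symm hu1).hasMFDerivAt)
    have h4 := hasFDerivAt_fst.comp u h3.hasFDerivAt
    refine h4.congr_fderiv ?_
    ext w
    have h5 := hψ.mfderiv_apply _ hu2 _ (hk (c.symm u) (mfderiv (𝓡 2) (𝓡 2) c.symm u w))
    exact congrArg Prod.fst h5
  have h3 : c ⁻¹' Metric.ball (c y) ε ∈ 𝓝 y :=
    c.continuousAt hyc (Metric.ball_mem_nhds _ hε)
  filter_upwards [h3, c.open_source.mem_nhds hyc] with z hz hzc
  have h4 := Metric.isOpen_ball.is_const_of_fderiv_eq_zero (convex_ball (c y) ε).isPreconnected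
    (fun u hu => (h2 u hu).differentiableAt.differentiableWithinAt) (fun u hu => (h2 u hu).fderiv)
    hz (Metric.mem_ball_self hε)
  simpa only [c.left_inv hzc, c.left_inv hyc] using h4

variable [A : AddAction (ℝ × ℝ) S] [T2Space S]

theorem IsParallel.eventually_mem_orbit (hP : P.IsParallel)
    (hA : IsGeneratedBy A (P.sharp 1) (P.sharp 2)) {N : Type*} [TopologicalSpace N]
    [ChartedSpace E2 N] [IsManifold (𝓡 2) ∞ N] {f : N → S} (hf : ContMDiff (𝓡 2) (𝓡 3) ∞ f)
    (hk : ∀ y v, P.e 0 (f y) (mfderiv (𝓡 2) (𝓡 3) f y v) = 0) (y : N) :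
    ∀ᶠ z in 𝓝 y, f z ∈ AddAction.orbit (ℝ × ℝ) (f y) := by
  obtain ⟨ψ, δ, hδ, hp, hψ, hb⟩ := hP.exists_actionBox hA (f y)
  have h1 : ∀ᶠ z in 𝓝 y, ψ (f z) ∈ Metric.ball (ψ (f y)) δ :=
    ((ψ.continuousAt hp).comp hf.continuous.continuousAt).eventually (Metric.ball_mem_nhds _ hδ)
  filter_upwards [hψ.eventually_fst_eq hf hk hp, h1,
    hf.continuous.continuousAt.eventually (ψ.open_source.mem_nhds hp)] with z hz hz1 hz2
  have h2 : ψ (f y) + (0, (ψ (f z)).2 - (ψ (f y)).2) = ψ (f z) := by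
    refine Prod.ext ?_ ?_
    · simp [hz]
    · simp
  -- The two points share their first coordinate, so the difference of the remaining ones is the
  -- group element joining them.
  refine ⟨(ψ (f z)).2 - (ψ (f y)).2, ?_⟩
  have h3 := hb.vadd_eq _ (Metric.mem_ball_self hδ) _ (h2.symm ▸ hz1)
  rwa [h2, ψ.left_inv hp, ψ.left_inv hz2] at h3

/-- Orbits partition `S`, so membership of `f y` in a fixed orbit is a locally constant condition on
the connected surface. -/
theorem IsParallel.subset_orbit (hP : P.IsParallel)
    (hA : IsGeneratedBy A (P.sharp 1) (P.sharp 2)) {L : Set S} (hL : IsIntegralSurface (P.e 0) L)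
    {p : S} (hp : p ∈ L) : L ⊆ AddAction.orbit (ℝ × ℝ) p := by
  obtain ⟨N, _, _, f, _, _, _, _, hf, -, -, hr, rfl⟩ := hL
  obtain ⟨x, rfl⟩ := hp
  rintro _ ⟨y, rfl⟩
  have hk : ∀ y v, P.e 0 (f y) (mfderiv (𝓡 2) (𝓡 3) f y v) = 0 := by
    intro y v
    have h : mfderiv (𝓡 2) (𝓡 3) f y v ∈ {v | P.e 0 (f y) v = 0} := hr y ▸ mem_range_self v
    exact h
  refine forall_of_eventually_iff (p := fun y => f y ∈ AddAction.orbit (ℝ × ℝ) (f x)) (x₀ := x)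
    (fun y => ?_) (AddAction.mem_orbit_self _) y
  filter_upwards [hP.eventually_mem_orbit hA hf hk y] with z hz
  have h : AddAction.orbit (ℝ × ℝ) (f z) = AddAction.orbit (ℝ × ℝ) (f y) :=
    AddAction.orbit_eq_iff.2 hz
  rw [← AddAction.orbit_eq_iff, ← AddAction.orbit_eq_iff, h]

/-- An integral surface lies in the orbit of any of its points, and that orbit is itself an integral
surface; this gives maximality of orbits and forces every leaf to be one. -/
theorem IsParallel.orbitSet_eq (hP : P.IsParallel)
    (hA : IsGeneratedBy A (P.sharp 1) (P.sharp 2)) :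
    orbitSet A = {L : Set S | IsLeaf (P.e 0) L} := by
  ext L
  rw [mem_ofPred_eq]
  constructor
  · rintro ⟨p, rfl⟩
    exact ⟨hP.isIntegralSurface_orbit hA p, fun L' hL' h =>
      (hP.subset_orbit hA hL' (h (AddAction.mem_orbit_self p))).antisymm h⟩
  · rintro ⟨hL, hmax⟩
    obtain ⟨p, hp⟩ : L.Nonempty := by
      obtain ⟨N, _, _, f, -, -, -, _, -, -, -, -, rfl⟩ := hL
      exact range_nonempty f
    exact ⟨p, hmax _ (hP.isIntegralSurface_orbit hA p) (hP.subset_orbit hA hL hp)⟩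

end CauchyPair

end

theorem mainTheorem10 (S : Type*) [TopologicalSpace S] [T2Space S] [SecondCountableTopology S]
    [ChartedSpace E3 S] [IsManifold (𝓡 3) ∞ S]
    (P : CauchyPair S) (hpar : P.IsParallel) (hcomp : P.IsComplete) :
    (IsSmoothVField (P.sharp 1) ∧ IsCompleteVField (P.sharp 1)) ∧
    (IsSmoothVField (P.sharp 2) ∧ IsCompleteVField (P.sharp 2)) ∧
    (∀ x : S, VectorField.mlieBracket (𝓡 3) (P.sharp 1) (P.sharp 2) x = 0) ∧
    ∃ A : AddAction (ℝ × ℝ) S,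
      IsGeneratedBy A (P.sharp 1) (P.sharp 2) ∧
      (∀ B : AddAction (ℝ × ℝ) S, IsGeneratedBy B (P.sharp 1) (P.sharp 2) → B = A) ∧
      IsSmoothAction A ∧
      IsLocallyFreeAction A ∧
      orbitSet A = {L : Set S | IsLeaf (P.e 0) L} := by
  refine ⟨⟨P.isSmooth_sharp 1, ?_⟩, ⟨P.isSmooth_sharp 2, ?_⟩, hpar.mlieBracket_eq_zero, ?_⟩
  · rw [← P.leafField_one_zero]
    exact hpar.isComplete_leafField hcomp (by norm_num)
  · rw [← P.leafField_zero_one]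
    exact hpar.isComplete_leafField hcomp (by norm_num)
  · obtain ⟨A, hA⟩ := hpar.exists_addAction hcomp
    exact ⟨A, hA, fun B hB => CauchyPair.addAction_unique hA hB, hpar.isSmoothAction hA,
      hpar.isLocallyFreeAction hA, hpar.orbitSet_eq hA⟩
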